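/- Fix $\theta>0$. For $n\ge 1$ let $\nu_n$ be the Ewens probability measure on the symmetric group $\mathbf S_n$, $\nu_n(\{\sigma\})=\theta^{w(\sigma)}/\big(\theta(\theta+1)\cdots(\theta+n-1)\big)$, where $w(\sigma)$ is the number of cycles of $\sigma$ (fixed points included). Let $J_n\subset\{1,\dots,n\}$, $n\ge1$, be arbitrary sets, let $w(\sigma,J_n)$ be the number of cycles of $\sigma\in\mathbf S_n$ whose lengths belong to $J_n$, let $V_n(x)=\nu_n\big(w(\sigma,J_n)<x\big)$ for $x\in\mathbb R$, and for $l\ge 1$ put \[ \upsilon_n(l)=\theta^l\sum_{\substack{j_1,\dots,j_l\in J_n\\ j_1+\cdots+j_l<n}}\frac{1}{j_1\cdots j_l}\Big(1-\frac{j_1+\cdots+j_l}{n}\Big)^{\theta-1}. \] For a random variable $Y$ with values in $\{0,1,2,\dots\}$ write $F_Y(x)=P(Y<x)$, and let $V_n\Rightarrow F_Y$ mean that $V_n(x)\to F_Y(x)$ as $n\to\infty$ at every continuity point $x$ of $F_Y$. Then there is a random variable $Y$ with values in $\{0,1,2,\dots\}$ such that $V_n\Rightarrow F_Y$ if and only if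 there is a real sequence $\upsilon(l)$, $l\ge1$, such that \[ \lim_{n\to\infty}\upsilon_n(l)=\upsilon(l)\qquad\text{for every } l\ge 1 . \] If the latter condition is satisfied, then a random variable $Y$ with values in $\{0,1,2,\dots\}$ satisfies $V_n\Rightarrow F_Y$ if and only if, for every $l\ge 1$, its factorial moment $\mathbf E\,Y(Y-1)\cdots(Y-l+1)$ is finite and equal to $\upsilon(l)$. -/

import Mathlib

open Filter Topology MeasureTheory

noncomputable section

namespace Ewens

/-- `k_j(σ)`: the number of cycles of length `j` of the permutation `σ` of an `n`-element set.
Fixed points are cycles of length `1` (`σ.partition` includes them, unlike `σ.cycleType`). -/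
def cycleCount {n : ℕ} (σ : Equiv.Perm (Fin n)) (j : ℕ) : ℕ :=
  σ.partition.parts.count j

/-- `w(σ) = k_1(σ) + ... + k_n(σ)`: the total number of cycles of `σ`, fixed points included. -/
def totalCycles {n : ℕ} (σ : Equiv.Perm (Fin n)) : ℕ :=
  ∑ j ∈ Finset.Icc 1 n, cycleCount σ j

/-- `w(σ, J)`: the number of cycles of `σ` whose lengths belong to `J`. -/
def cyclesIn {n : ℕ} (σ : Equiv.Perm (Fin n)) (J : Finset ℕ) : ℕ :=
  ∑ j ∈ J, cycleCount σ j

/-- The rising factorial `θ^{(n)} = θ (θ + 1) ⋯ (θ + n - 1)`. -/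
def risingFactorial (θ : ℝ) (n : ℕ) : ℝ :=
  ∏ i ∈ Finset.range n, (θ + (i : ℝ))

open Classical in
/-- The Ewens probability `ν_n(A)` with parameter `θ` of a set `A` of permutations: each `σ`
has probability `θ ^ w(σ) / θ^{(n)}`. -/
def ewensProb (θ : ℝ) (n : ℕ) (A : Set (Equiv.Perm (Fin n))) : ℝ :=
  ∑ σ : Equiv.Perm (Fin n) with σ ∈ A, θ ^ totalCycles σ / risingFactorial θ n

/-- `V_n(x) = ν_n(w(σ, J_n) < x)`, the distribution function of the number of cycles with
lengths in `J n` (distribution functions are taken left-continuous). -/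
def cycleDistFun (θ : ℝ) (J : ℕ → Finset ℕ) (n : ℕ) (x : ℝ) : ℝ :=
  ewensProb θ n {σ | (cyclesIn σ (J n) : ℝ) < x}

/-- `F_Y(x) = P(Y < x)` for a random variable `Y` with values in `{0, 1, 2, ...}` and law `μ`. -/
def lawDistFun (μ : Measure ℕ) (x : ℝ) : ℝ :=
  μ.real {k : ℕ | (k : ℝ) < x}

/-- Weak convergence `F_n ⇒ F` of distribution functions: convergence at every continuity
point of the limit. -/
def WeakConv (F : ℕ → ℝ → ℝ) (G : ℝ → ℝ) : Prop :=
  ∀ x : ℝ, ContinuousAt G x → Tendsto (fun n => F n x) atTop (𝓝 (G x))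

/-- `υ_n(l) = θ^l ∑ (1 / (j_1 ⋯ j_l)) (1 - (j_1 + ⋯ + j_l) / n)^(θ - 1)`, the sum being over all
`(j_1, ..., j_l)` with every `j_i ∈ J n` and `j_1 + ⋯ + j_l < n`. -/
def upsilon (θ : ℝ) (J : ℕ → Finset ℕ) (n l : ℕ) : ℝ :=
  θ ^ l * ∑ j ∈ Fintype.piFinset (fun _ : Fin l => J n) with ∑ i, j i < n,
    (1 / ∏ i, (j i : ℝ)) * (1 - (∑ i, (j i : ℝ)) / (n : ℝ)) ^ (θ - 1)

end Ewens

end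

open scoped Nat

namespace Ewens

/-! Put a_n = θ^{(n)}/n! and let T_l(m) be the sum of 1/(j_1⋯j_l) over l-tuples in J_n with sum m.
Counting conjugacy classes gives the exact formula E[w]_l = θ^l ∑_{m≤n} T_l(m) a_{n-m}/a_n for the
factorial moments of w = w(σ, J_n) (`sum_descFactorial_cyclesIn`). Since a_n ~ n^{θ-1}/Γ(θ), the
ratio is close to (1 - m/n)^{θ-1} and the formula becomes υ_n(l). The comparison fails only for m
near n, where (1 - m/n)^{θ-1} is singular if θ < 1; there T_l(m) = O(1/n), and n·a_n → ∞ makes the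
contribution vanish.

All of this requires D_n = ∑_{j∈J_n} 1/j to be bounded. If υ_n(1) converges, this is immediate from
υ_n(1) ≥ c(D_n - 2). If the laws converge, it follows from tightness: E w ≥ θc(D_n - 2) while E w² =
O(D_n²), so an unbounded D_n would push a fixed proportion of mass to infinity
(`exists_recipSum_le_of_tendsto`).

Once D_n ≤ C, E[w]_l is at most θ^l A(l+1)C^l and differs from υ_n(l) by o(1)
(`exists_momentSum_le`, `tendsto_momentSum_sub`). Under such growth, convergence of laws and
convergence of factorial moments are equivalent and the moments determine the law (`tendsto_moment`,
`tendsto_of_tendsto_moment`, `eq_tsum_of_hasSum_moment`). -/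

/-! ### Exact factorial moments through weighted sums over partitions. -/

theorem prod_factorial_count_cons (j : ℕ) (s : Multiset ℕ) :
    ∏ i ∈ (j ::ₘ s).toFinset, ((j ::ₘ s).count i)! =
      (s.count j + 1) * ∏ i ∈ s.toFinset, (s.count i)! := by
  have hs : ∏ i ∈ s.toFinset, (s.count i)! = ∏ i ∈ insert j s.toFinset, (s.count i)! := by
    refine Finset.prod_subset (Finset.subset_insert _ _) fun i _ hi => ?_
    rw [Multiset.count_eq_zero_of_notMem (by simpa using hi), Nat.factorial_zero]
  rw [hs, Multiset.toFinset_cons, ← Finset.mul_prod_erase _ _ (Finset.mem_insert_self j _),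
    ← Finset.mul_prod_erase (insert j s.toFinset) (fun i => (s.count i)!)
      (Finset.mem_insert_self j _), ← mul_assoc, Multiset.count_cons_self, Nat.factorial_succ]
  congr 1
  refine Finset.prod_congr rfl fun i hi => ?_
  rw [Multiset.count_cons_of_ne (Finset.ne_of_mem_erase hi)]

/-- The weight `θ ^ (number of parts) / z_s` of a multiset `s` of cycle lengths, where
`z_s = ∏ j ^ (m_j) m_j!`. -/
noncomputable def cycleWeight (θ : ℝ) (s : Multiset ℕ) : ℝ :=
  θ ^ s.card / ((s.prod * ∏ i ∈ s.toFinset, (s.count i)! : ℕ) : ℝ)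

/-- Adding a part `j` multiplies `z_s` by `j (m_j + 1)`, and `m_j + 1` cancels against the new
count. This is what makes removing a marked cycle cost exactly `θ / j`. -/
theorem cycleWeight_cons_mul_count (θ : ℝ) (j : ℕ) (s : Multiset ℕ) :
    cycleWeight θ (j ::ₘ s) * ((j ::ₘ s).count j : ℝ) = θ / j * cycleWeight θ s := by
  have h : ((s.count j : ℝ) + 1) ≠ 0 := by positivity
  simp only [cycleWeight, prod_factorial_count_cons, Multiset.prod_cons, Multiset.card_cons,
    Multiset.count_cons_self]
  push_cast
  rw [div_mul_div_comm, div_mul_eq_mul_div, pow_succ',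
    show (j : ℝ) * (s.map (Nat.cast : ℕ → ℝ)).prod *
      (((s.count j : ℝ) + 1) * ∏ i ∈ s.toFinset, ((s.count i)! : ℝ)) =
      (j * ((s.map (Nat.cast : ℕ → ℝ)).prod * ∏ i ∈ s.toFinset, ((s.count i)! : ℝ))) *
        ((s.count j : ℝ) + 1) by ring, mul_div_mul_right _ _ h]

-- Cauchy's formula for the size of a conjugacy class. `card_of_cycleType_mul_eq` states it for
-- `cycleType`, which omits fixed points; the parts equal to 1 do not change the product and
-- contribute `(p.parts.count 1)!`.
open Equiv.Perm in
theorem card_partition_eq_mul {α : Type*} [Fintype α] [DecidableEq α]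
    (p : (Fintype.card α).Partition) :
    (Finset.univ.filter fun σ : Equiv.Perm α => σ.partition = p).card *
      (p.parts.prod * ∏ i ∈ p.parts.toFinset, (p.parts.count i)!) = (Fintype.card α)! := by
  set m := p.parts.filter (2 ≤ ·) with hm
  have hp : p.parts = m + Multiset.replicate (p.parts.count 1) 1 := by
    rw [← Multiset.filter_eq', hm]
    ext i
    rw [Multiset.count_add, Multiset.count_filter, Multiset.count_filter]
    rcases Nat.lt_trichotomy i 1 with h | h | h
    · have : i = 0 := by omega
      subst this
      simpa using fun h => (p.parts_pos h).ne rfl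
    · subst h; simp
    · simp [h.ne', Nat.succ_le_iff.2 h]
  have hsum : m.sum + p.parts.count 1 = Fintype.card α := by
    conv_rhs => rw [← p.parts_sum, hp]
    simp
  have hm2 : ∀ a ∈ m, 2 ≤ a := fun a ha => (Multiset.mem_filter.1 ha).2
  have hm1 : 1 ∉ m := fun h => by simpa using hm2 1 h
  have hset : (Finset.univ.filter fun σ : Equiv.Perm α => σ.partition = p) =
      Finset.univ.filter fun σ : Equiv.Perm α => σ.cycleType = m := by
    refine Finset.filter_congr fun σ _ => ⟨fun h => ?_, fun h => ?_⟩
    · rw [hm, ← h, filter_parts_partition_eq_cycleType]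
    · rw [Nat.Partition.ext_iff, parts_partition, hp, h, ← sum_cycleType, h]
      congr 2
      omega
  have key := card_of_cycleType_mul_eq α m
  rw [if_pos ⟨by omega, hm2⟩] at key
  rw [hset, ← key]
  congr 1
  have h1 : p.parts.prod = m.prod := by
    conv_lhs => rw [hp]
    simp
  have h2 : ∏ i ∈ p.parts.toFinset, (p.parts.count i)! =
      (p.parts.count 1)! * ∏ i ∈ m.toFinset, (m.count i)! := by
    have : ∏ i ∈ p.parts.toFinset, (p.parts.count i)! =
        ∏ i ∈ insert 1 m.toFinset, (p.parts.count i)! := by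
      refine Finset.prod_subset (fun i hi => ?_) fun i _ hi => ?_
      · rw [hp] at hi
        simp only [Multiset.mem_toFinset, Multiset.mem_add, Multiset.mem_replicate] at hi
        simp only [Finset.mem_insert, Multiset.mem_toFinset]
        tauto
      · rw [Multiset.count_eq_zero_of_notMem (by simpa using hi), Nat.factorial_zero]
    rw [this, Finset.prod_insert (by simpa using hm1)]
    congr 1
    refine Finset.prod_congr rfl fun i hi => ?_
    rw [Multiset.mem_toFinset] at hi
    rw [hm, Multiset.count_filter, if_pos (hm2 i hi)]
  rw [h1, h2, show Fintype.card α - m.sum = p.parts.count 1 by omega]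
  ring

theorem cycleWeight_eq_card {α : Type*} [Fintype α] [DecidableEq α] (θ : ℝ)
    (p : (Fintype.card α).Partition) :
    ((Finset.univ.filter fun σ : Equiv.Perm α => σ.partition = p).card : ℝ) * θ ^ p.parts.card =
      (Fintype.card α)! * cycleWeight θ p.parts := by
  have h := card_partition_eq_mul p
  have hz : ((p.parts.prod * ∏ i ∈ p.parts.toFinset, (p.parts.count i)! : ℕ) : ℝ) ≠ 0 := by
    intro h0
    rw [Nat.cast_eq_zero] at h0
    rw [h0, mul_zero] at h
    exact Nat.factorial_ne_zero _ h.symm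
  rw [cycleWeight, ← h, Nat.cast_mul]
  field_simp

theorem sum_perm_eq_sum_partition {α : Type*} [Fintype α] [DecidableEq α] (θ : ℝ)
    (f : Multiset ℕ → ℝ) :
    ∑ σ : Equiv.Perm α, θ ^ σ.partition.parts.card * f σ.partition.parts =
      (Fintype.card α)! *
        ∑ p : (Fintype.card α).Partition, cycleWeight θ p.parts * f p.parts := by
  rw [← Finset.sum_fiberwise_of_maps_to (s := Finset.univ) (t := Finset.univ)
    (g := fun σ : Equiv.Perm α => σ.partition) (fun _ _ => Finset.mem_univ _), Finset.mul_sum]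
  refine Finset.sum_congr rfl fun p _ => ?_
  rw [← mul_assoc, ← cycleWeight_eq_card]
  rw [Finset.sum_congr rfl (g := fun _ => θ ^ p.parts.card * f p.parts), Finset.sum_const,
    nsmul_eq_mul, mul_assoc]
  intro σ hσ
  rw [(Finset.mem_filter.1 hσ).2]

/-- Only partitions containing `j` count, and deleting one such part is a bijection onto the
partitions of `n - j`. -/
theorem sum_partition_mul_count (θ : ℝ) {n j : ℕ} (hj : 1 ≤ j) (hjn : j ≤ n)
    (f : Multiset ℕ → ℝ) :
    ∑ p : n.Partition, cycleWeight θ p.parts * p.parts.count j * f p.parts =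
      θ / j * ∑ p : (n - j).Partition, cycleWeight θ p.parts * f (j ::ₘ p.parts) := by
  classical
  have h1 : ∑ p : n.Partition, cycleWeight θ p.parts * p.parts.count j * f p.parts =
      ∑ p : {p : n.Partition // j ∈ p.parts},
        cycleWeight θ p.1.parts * p.1.parts.count j * f p.1.parts := by
    rw [← Finset.sum_subtype (Finset.univ.filter fun p : n.Partition => j ∈ p.parts) (by simp)
      (fun p : n.Partition => cycleWeight θ p.parts * p.parts.count j * f p.parts),
      Finset.sum_filter]
    refine Finset.sum_congr rfl fun p _ => ?_
    split_ifs with h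
    · rfl
    · rw [Multiset.count_eq_zero_of_notMem h]; simp
  rw [h1, Finset.mul_sum]
  refine Fintype.sum_equiv (Nat.Partition.partitionWithPartEquiv hj hjn) _ _ fun p => ?_
  have hp : p.1.parts = j ::ₘ (Nat.Partition.partitionWithPartEquiv hj hjn p).parts := by
    simp [Nat.Partition.partitionWithPartEquiv, Multiset.cons_erase p.2]
  rw [hp, cycleWeight_cons_mul_count]
  ring

/-- The number of elements of `s`, with multiplicity, that lie in `J`. -/
def countIn (J : Finset ℕ) (s : Multiset ℕ) : ℕ := ∑ j ∈ J, s.count j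

theorem countIn_cons {J : Finset ℕ} {j : ℕ} (hj : j ∈ J) (s : Multiset ℕ) :
    countIn J (j ::ₘ s) = countIn J s + 1 := by
  simp [countIn, Multiset.count_cons, Finset.sum_add_distrib, hj]

/-- The weighted sum over partitions of `n` of the factorial power of order `l` of the number of
parts in `J`. -/
noncomputable def partitionMoment (θ : ℝ) (J : Finset ℕ) (l n : ℕ) : ℝ :=
  ∑ p : n.Partition, cycleWeight θ p.parts * ((countIn J p.parts).descFactorial l : ℝ)

theorem partitionMoment_succ (θ : ℝ) {J : Finset ℕ} (hJ : 0 ∉ J) (l n : ℕ) :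
    partitionMoment θ J (l + 1) n =
      ∑ j ∈ J with j ≤ n, θ / j * partitionMoment θ J l (n - j) := by
  -- The truncated `w - 1` is harmless at `w = 0` because of the factor `w`. Writing that factor as
  -- a sum of counts over `J` marks one cycle, whose removal lowers `w` by one.
  have h (w : ℕ) : w.descFactorial (l + 1) = w * (w - 1).descFactorial l := by
    cases w with
    | zero => simp
    | succ w => rw [Nat.succ_descFactorial_succ, Nat.add_sub_cancel]
  have h1 : partitionMoment θ J (l + 1) n = ∑ j ∈ J, ∑ p : n.Partition,
      cycleWeight θ p.parts * p.parts.count j *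
        ((countIn J p.parts - 1).descFactorial l : ℝ) := by
    rw [Finset.sum_comm]
    refine Finset.sum_congr rfl fun p _ => ?_
    rw [h, Nat.cast_mul, ← Finset.sum_mul, ← Finset.mul_sum, mul_assoc]
    congr 2
    simp [countIn]
  rw [h1, Finset.sum_filter]
  refine Finset.sum_congr rfl fun j hj => ?_
  have hj1 : 1 ≤ j := Nat.one_le_iff_ne_zero.2 fun h => hJ (h ▸ hj)
  split_ifs with hjn
  · rw [sum_partition_mul_count θ hj1 hjn
      (fun s => ((countIn J s - 1).descFactorial l : ℝ)), partitionMoment]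
    simp only [countIn_cons hj, Nat.add_sub_cancel]
  · refine Finset.sum_eq_zero fun p _ => ?_
    rw [Multiset.count_eq_zero_of_notMem fun h => hjn (p.le_of_mem_parts h)]
    simp

/-- The normalised rising factorial `θ (θ + 1) ⋯ (θ + n - 1) / n!`. -/
noncomputable def risingCoeff (θ : ℝ) (n : ℕ) : ℝ := risingFactorial θ n / n !

theorem risingCoeff_zero (θ : ℝ) : risingCoeff θ 0 = 1 := by
  simp [risingCoeff, risingFactorial]

theorem succ_mul_risingCoeff (θ : ℝ) (n : ℕ) :
    ((n : ℝ) + 1) * risingCoeff θ (n + 1) = (θ + n) * risingCoeff θ n := by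
  have : (n ! : ℝ) ≠ 0 := by positivity
  have : (n : ℝ) + 1 ≠ 0 := by positivity
  rw [risingCoeff, risingCoeff, risingFactorial, Finset.prod_range_succ, ← risingFactorial,
    Nat.factorial_succ]
  push_cast
  field_simp

/-- Coefficient form of A' = θA/(1 - x) for A = (1 - x)^{-θ}. It identifies the total weight of the
partitions of `n`, and later evaluates the sums of `risingCoeff` in the moment bound. -/
theorem mul_sum_risingCoeff (θ : ℝ) (n : ℕ) :
    θ * ∑ k ∈ Finset.range n, risingCoeff θ k = n * risingCoeff θ n := by
  induction n with
  | zero => simp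
  | succ n ih =>
    rw [Finset.sum_range_succ, mul_add, ih]
    push_cast
    rw [succ_mul_risingCoeff]
    ring

/-- Weight each partition by n = ∑ j·m_j and remove a part: the recursion is the one satisfied by
`risingCoeff`. -/
theorem mul_partitionMoment_zero (θ : ℝ) (J : Finset ℕ) (n : ℕ) :
    n * partitionMoment θ J 0 n = θ * ∑ k ∈ Finset.range n, partitionMoment θ J 0 k := by
  have h1 : n * partitionMoment θ J 0 n = ∑ j ∈ Finset.Icc 1 n, (j : ℝ) *
      ∑ p : n.Partition, cycleWeight θ p.parts * p.parts.count j * (1 : ℝ) := by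
    simp only [partitionMoment, Finset.mul_sum]
    rw [Finset.sum_comm]
    refine Finset.sum_congr rfl fun p _ => ?_
    have : (n : ℝ) = ∑ j ∈ Finset.Icc 1 n, (p.parts.count j : ℝ) * j := by
      have h : p.parts.sum = ∑ j ∈ Finset.Icc 1 n, p.parts.count j * j := by
        rw [Finset.sum_multiset_count_of_subset _ (Finset.Icc 1 n)]
        · simp
        · intro i hi
          rw [Multiset.mem_toFinset] at hi
          exact Finset.mem_Icc.2 ⟨p.parts_pos hi, p.le_of_mem_parts hi⟩
      rw [p.parts_sum] at h
      exact_mod_cast h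
    conv_lhs => rw [this, Finset.sum_mul]
    refine Finset.sum_congr rfl fun j _ => ?_
    simp
    ring
  rw [h1, ← Finset.sum_range_reflect, Finset.mul_sum, Finset.range_eq_Ico]
  refine Finset.sum_bij' (fun j _ => j - 1) (fun k _ => k + 1) ?_ ?_ ?_ ?_ ?_
  · intro j hj; simp at hj ⊢; omega
  · intro j hj; simp at hj ⊢; omega
  · intro j hj; simp at hj ⊢; omega
  · intro j hj; simp at hj ⊢
  · intro j hj
    obtain ⟨hj1, hjn⟩ := Finset.mem_Icc.1 hj
    rw [sum_partition_mul_count θ hj1 hjn fun _ => 1]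
    have : (j : ℝ) ≠ 0 := by positivity
    rw [show n - 1 - (j - 1) = n - j by omega, ← mul_assoc, mul_div_cancel₀ _ this]
    simp [partitionMoment]

theorem partitionMoment_zero (θ : ℝ) (J : Finset ℕ) (n : ℕ) :
    partitionMoment θ J 0 n = risingCoeff θ n := by
  induction n using Nat.strong_induction_on with
  | _ n ih =>
    rcases Nat.eq_zero_or_pos n with rfl | hn
    · rw [risingCoeff_zero, partitionMoment, Fintype.sum_unique]
      simp [cycleWeight]
    · have h := mul_partitionMoment_zero θ J n
      rw [Finset.sum_congr rfl fun k hk => ih k (Finset.mem_range.1 hk),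
        mul_sum_risingCoeff] at h
      exact mul_left_cancel₀ (by positivity) h

open Polynomial in
/-- The polynomial `∑ X ^ j / j` over `j ∈ J`. -/
noncomputable def cyclePoly (J : Finset ℕ) : ℝ[X] := ∑ j ∈ J, Polynomial.monomial j (1 / (j : ℝ))

/-- The sum of `1 / (j_1 ⋯ j_l)` over the `l`-tuples in `J` with sum `m`. -/
noncomputable def tupleWeight (J : Finset ℕ) (l m : ℕ) : ℝ := ((cyclePoly J) ^ l).coeff m

theorem mk_partitionMoment_succ (θ : ℝ) {J : Finset ℕ} (hJ : 0 ∉ J) (l : ℕ) :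
    PowerSeries.mk (partitionMoment θ J (l + 1)) =
      PowerSeries.C θ * (cyclePoly J : PowerSeries ℝ) * PowerSeries.mk (partitionMoment θ J l) := by
  ext n
  rw [PowerSeries.coeff_mk, partitionMoment_succ θ hJ, mul_assoc, PowerSeries.coeff_C_mul,
    PowerSeries.coeff_mul, Finset.Nat.sum_antidiagonal_eq_sum_range_succ_mk, Finset.mul_sum]
  simp only [Polynomial.coeff_coe, PowerSeries.coeff_mk, cyclePoly, Polynomial.finsetSum_coeff,
    Polynomial.coeff_monomial, Finset.sum_ite_eq']
  rw [Finset.sum_filter, ← Finset.sum_subset (s₁ := J.filter (· ≤ n)) (s₂ := Finset.range n.succ),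
    Finset.sum_filter]
  · refine Finset.sum_congr rfl fun j hj => ?_
    simp [hj, div_eq_mul_inv, mul_assoc]
  · intro j hj
    simp at hj ⊢
    omega
  · intro j hj hj'
    have : j ∉ J := by simp at hj hj' ⊢; intro h; have := hj' h; omega
    simp [this]

/-- In generating functions the recursion in `l` is multiplication by `θ * cyclePoly J`, so the
series is (θP)^l (1 - x)^{-θ} with P = `cyclePoly J`. -/
theorem partitionMoment_eq (θ : ℝ) {J : Finset ℕ} (hJ : 0 ∉ J) (l n : ℕ) :
    partitionMoment θ J l n =
      θ ^ l * ∑ m ∈ Finset.range (n + 1), tupleWeight J l m * risingCoeff θ (n - m) := by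
  have h : PowerSeries.mk (partitionMoment θ J l) =
      (PowerSeries.C θ * (cyclePoly J : PowerSeries ℝ)) ^ l *
        PowerSeries.mk (partitionMoment θ J 0) := by
    induction l with
    | zero => simp
    | succ l ih => rw [mk_partitionMoment_succ θ hJ, ih, pow_succ']; ring
  have := congrArg (PowerSeries.coeff n) h
  rw [PowerSeries.coeff_mk, mul_pow, mul_assoc, ← map_pow, PowerSeries.coeff_C_mul,
    PowerSeries.coeff_mul, Finset.Nat.sum_antidiagonal_eq_sum_range_succ_mk,
    ← Polynomial.coe_pow] at this
  simpa only [partitionMoment_zero, tupleWeight, Polynomial.coeff_coe,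
    PowerSeries.coeff_mk] using this

theorem totalCycles_eq_card {n : ℕ} (σ : Equiv.Perm (Fin n)) :
    totalCycles σ = σ.partition.parts.card := by
  rw [totalCycles, ← Multiset.sum_count_eq_card (s := Finset.Icc 1 n)]
  · rfl
  · intro i hi
    have := σ.partition.le_of_mem_parts hi
    rw [Fintype.card_fin] at this
    exact Finset.mem_Icc.2 ⟨σ.partition.parts_pos hi, this⟩

/-- The Ewens factorial moments of the number of cycles with lengths in `J`. -/
theorem sum_descFactorial_cyclesIn (θ : ℝ) (hθ : 0 < θ) {J : Finset ℕ} (hJ : 0 ∉ J) (l n : ℕ) :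
    ∑ σ : Equiv.Perm (Fin n), θ ^ totalCycles σ / risingFactorial θ n *
        ((cyclesIn σ J).descFactorial l : ℝ) =
      θ ^ l * ∑ m ∈ Finset.range (n + 1),
        tupleWeight J l m * (risingCoeff θ (n - m) / risingCoeff θ n) := by
  have h := sum_perm_eq_sum_partition (α := Fin n) θ
    fun s => ((countIn J s).descFactorial l : ℝ)
  replace h := h.trans
    (congrArg (fun N : ℕ => (N ! : ℝ) * partitionMoment θ J l N) (Fintype.card_fin n))
  simp only [partitionMoment_eq θ hJ] at h
  have hr : risingFactorial θ n ≠ 0 := by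
    refine (Finset.prod_pos fun i _ => ?_).ne'
    positivity
  simp only [div_mul_eq_mul_div, ← Finset.sum_div, ← mul_div_assoc, totalCycles_eq_card]
  change (∑ σ : Equiv.Perm (Fin n), θ ^ σ.partition.parts.card *
    ((countIn J σ.partition.parts).descFactorial l : ℝ)) / _ = _
  rw [h, risingCoeff.eq_def θ n]
  have : (n ! : ℝ) ≠ 0 := by positivity
  field_simp

/-! ### Tuple weights: total mass, pointwise decay, and their relation to `upsilon`. -/

/-- The sum of the reciprocals of the elements of `J`. -/
noncomputable def recipSum (J : Finset ℕ) : ℝ := ∑ j ∈ J, 1 / (j : ℝ)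

theorem cyclePoly_coeff (J : Finset ℕ) (m : ℕ) :
    (cyclePoly J).coeff m = if m ∈ J then 1 / (m : ℝ) else 0 := by
  simp [cyclePoly, Polynomial.finsetSum_coeff, Polynomial.coeff_monomial]

theorem tupleWeight_one (J : Finset ℕ) (m : ℕ) :
    tupleWeight J 1 m = if m ∈ J then 1 / (m : ℝ) else 0 := by
  rw [tupleWeight, pow_one, cyclePoly_coeff]

theorem tupleWeight_succ (J : Finset ℕ) (l m : ℕ) :
    tupleWeight J (l + 1) m =
      ∑ x ∈ Finset.HasAntidiagonal.antidiagonal m, tupleWeight J l x.1 * (cyclePoly J).coeff x.2 := by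
  rw [tupleWeight, pow_succ, Polynomial.coeff_mul]
  rfl

theorem tupleWeight_nonneg (J : Finset ℕ) (l m : ℕ) : 0 ≤ tupleWeight J l m := by
  induction l generalizing m with
  | zero =>
    rw [tupleWeight, pow_zero, Polynomial.coeff_one]
    split_ifs <;> norm_num
  | succ l ih =>
    rw [tupleWeight_succ]
    refine Finset.sum_nonneg fun x _ => mul_nonneg (ih _) ?_
    rw [cyclePoly_coeff]
    split_ifs <;> positivity

/-- The total mass is the value of `cyclePoly J ^ l` at 1. -/
theorem sum_tupleWeight_le (J s : Finset ℕ) (l : ℕ) :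
    ∑ m ∈ s, tupleWeight J l m ≤ recipSum J ^ l := by
  have h : ((cyclePoly J) ^ l).eval 1 = recipSum J ^ l := by
    rw [Polynomial.eval_pow, cyclePoly, Polynomial.eval_finsetSum, recipSum]
    simp
  rw [← h, Polynomial.eval_eq_sum, Polynomial.sum_def]
  simp only [one_pow, mul_one]
  rw [← Finset.sum_filter_add_sum_filter_not s (· ∈ ((cyclePoly J) ^ l).support),
    Finset.sum_eq_zero (s := s.filter (· ∉ ((cyclePoly J) ^ l).support)), add_zero]
  · exact Finset.sum_le_sum_of_subset_of_nonneg (fun i hi => (Finset.mem_filter.1 hi).2)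
      fun i _ _ => tupleWeight_nonneg J l i
  · intro i hi
    simpa [tupleWeight] using (Finset.mem_filter.1 hi).2

/-- Differentiate: (P^l)' = l P^{l-1} P', and P' has coefficients 0 or 1, so m·T_l(m) is at most l
times the mass of P^{l-1}. Hence T_l(m) = O(1/m), which prevents concentration near m = n. -/
theorem mul_tupleWeight_le {J : Finset ℕ} {C : ℝ} (hC : 1 ≤ C) (hJC : recipSum J ≤ C)
    (l m : ℕ) : m * tupleWeight J l m ≤ l * C ^ l := by
  have h0 : 0 ≤ recipSum J := Finset.sum_nonneg fun _ _ => by positivity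
  rcases m with _ | m
  · simp; positivity
  rcases l with _ | l
  · simp [tupleWeight, Polynomial.coeff_one]
  have h := congrArg (fun p => p.coeff m) (Polynomial.derivative_pow_succ (cyclePoly J) l)
  simp only [Polynomial.coeff_derivative] at h
  rw [mul_assoc, Polynomial.coeff_C_mul, Polynomial.coeff_mul] at h
  have hle : ∑ x ∈ Finset.HasAntidiagonal.antidiagonal m, ((cyclePoly J) ^ l).coeff x.1 *
      (Polynomial.derivative (cyclePoly J)).coeff x.2 ≤ C ^ l := by
    calc _ ≤ ∑ x ∈ Finset.HasAntidiagonal.antidiagonal m, tupleWeight J l x.1 := by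
          refine Finset.sum_le_sum fun x _ => ?_
          refine mul_le_of_le_one_right (tupleWeight_nonneg J l _) ?_
          rw [Polynomial.coeff_derivative, cyclePoly_coeff]
          split_ifs
          · push_cast
            rw [one_div_mul_cancel (by positivity)]
          · simp
      _ = ∑ i ∈ Finset.range (m + 1), tupleWeight J l i :=
          Finset.Nat.sum_antidiagonal_eq_sum_range_succ (fun i _ => tupleWeight J l i) m
      _ ≤ recipSum J ^ l := sum_tupleWeight_le _ _ _
      _ ≤ C ^ l := pow_le_pow_left₀ h0 hJC l
  have h2 : ((m + 1 : ℕ) : ℝ) * tupleWeight J (l + 1) (m + 1) ≤ (l + 1) * C ^ l := by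
    rw [tupleWeight, mul_comm]
    push_cast
    rw [h]
    gcongr
  refine h2.trans ?_
  push_cast
  gcongr
  omega

theorem cyclePoly_pow (J : Finset ℕ) (l : ℕ) :
    (cyclePoly J) ^ l = ∑ j ∈ Fintype.piFinset (fun _ : Fin l => J),
      Polynomial.monomial (∑ i, j i) (1 / ∏ i, (j i : ℝ)) := by
  rw [cyclePoly, Finset.sum_pow']
  refine Finset.sum_congr rfl fun j _ => ?_
  have (s : Finset (Fin l)) : ∏ i ∈ s, Polynomial.monomial (j i) (1 / (j i : ℝ)) =
      Polynomial.monomial (∑ i ∈ s, j i) (1 / ∏ i ∈ s, (j i : ℝ)) := by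
    induction s using Finset.induction_on with
    | empty => simp
    | insert a s ha ih =>
      rw [Finset.prod_insert ha, ih, Polynomial.monomial_mul_monomial, Finset.sum_insert ha,
        Finset.prod_insert ha, one_div_mul_one_div]
  exact this _

theorem tupleWeight_eq_sum (J : Finset ℕ) (l m : ℕ) :
    tupleWeight J l m = ∑ j ∈ Fintype.piFinset (fun _ : Fin l => J) with ∑ i, j i = m,
      1 / ∏ i, (j i : ℝ) := by
  rw [tupleWeight, cyclePoly_pow, Polynomial.finsetSum_coeff, Finset.sum_filter]
  simp only [Polynomial.coeff_monomial]

theorem upsilon_eq (θ : ℝ) (J : ℕ → Finset ℕ) (n l : ℕ) :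
    upsilon θ J n l = θ ^ l * ∑ m ∈ Finset.range n,
      tupleWeight (J n) l m * (1 - (m : ℝ) / n) ^ (θ - 1) := by
  rw [upsilon, ← Finset.sum_fiberwise_of_maps_to (t := Finset.range n)
    (g := fun j : Fin l → ℕ => ∑ i, j i)
    (fun j hj => Finset.mem_range.2 (Finset.mem_filter.1 hj).2)]
  congr 1
  refine Finset.sum_congr rfl fun m hm => ?_
  rw [tupleWeight_eq_sum, Finset.sum_mul, Finset.filter_filter]
  refine Finset.sum_congr ?_ fun j hj => ?_
  · refine Finset.filter_congr fun j _ => ⟨fun h => h.2, fun h => ⟨?_, h⟩⟩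
    rw [h]; exact Finset.mem_range.1 hm
  · rw [← (Finset.mem_filter.1 hj).2]
    push_cast
    rfl

/-! ### Asymptotics of `risingCoeff` and of its ratios. -/

variable {θ : ℝ}

theorem risingCoeff_pos (hθ : 0 < θ) (n : ℕ) : 0 < risingCoeff θ n := by
  have : 0 < risingFactorial θ n := Finset.prod_pos fun i _ => by positivity
  rw [risingCoeff]
  positivity

/-- Euler's limit: the quotient equals (n/(n + θ)) / `GammaSeq θ n`. -/
theorem tendsto_risingCoeff_div_rpow (hθ : 0 < θ) :
    Tendsto (fun n : ℕ => risingCoeff θ n / (n : ℝ) ^ (θ - 1)) atTop (𝓝 (Real.Gamma θ)⁻¹) := by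
  have h1 : Tendsto (fun n : ℕ => (n : ℝ) / (n + θ)) atTop (𝓝 1) :=
    tendsto_natCast_div_add_atTop θ
  have h2 := h1.mul ((Real.GammaSeq_tendsto_Gamma θ).inv₀ (Real.Gamma_pos_of_pos hθ).ne')
  rw [one_mul] at h2
  refine h2.congr' ?_
  filter_upwards [eventually_gt_atTop 0] with n hn
  have hn' : (0 : ℝ) < n := by exact_mod_cast hn
  have hr : 0 < risingFactorial θ n := Finset.prod_pos fun i _ => by positivity
  have hp : (0 : ℝ) < (n : ℝ) ^ θ := Real.rpow_pos_of_pos hn' _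
  rw [Real.GammaSeq, risingCoeff, Finset.prod_range_succ, ← risingFactorial,
    Real.rpow_sub_one hn'.ne']
  have : (n : ℝ) + θ ≠ 0 := by positivity
  have : θ + (n : ℝ) ≠ 0 := by positivity
  field_simp
  ring

theorem exists_risingCoeff_bounds (hθ : 0 < θ) :
    ∃ c K : ℝ, 0 < c ∧ 0 < K ∧ ∀ n : ℕ, 1 ≤ n →
      c * (n : ℝ) ^ (θ - 1) ≤ risingCoeff θ n ∧ risingCoeff θ n ≤ K * (n : ℝ) ^ (θ - 1) := by
  have h := tendsto_risingCoeff_div_rpow hθ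
  have hL : 0 < (Real.Gamma θ)⁻¹ := inv_pos.2 (Real.Gamma_pos_of_pos hθ)
  obtain ⟨K, hK⟩ := h.bddAbove_range
  obtain ⟨K', hK'⟩ := (h.inv₀ hL.ne').bddAbove_range
  have hpos (n : ℕ) (hn : 1 ≤ n) : 0 < (n : ℝ) ^ (θ - 1) :=
    Real.rpow_pos_of_pos (by exact_mod_cast hn) _
  refine ⟨(max K' 1)⁻¹, max K 1, by positivity, by positivity, fun n hn => ⟨?_, ?_⟩⟩
  · have := hK' ⟨n, rfl⟩
    simp only [inv_div] at this
    rw [div_le_iff₀ (risingCoeff_pos hθ n)] at this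
    rw [inv_mul_le_iff₀ (by positivity)]
    exact this.trans (mul_le_mul_of_nonneg_right (le_max_left _ _) (risingCoeff_pos hθ n).le)
  · have := hK ⟨n, rfl⟩
    simp only at this
    rw [div_le_iff₀ (hpos n hn)] at this
    exact this.trans (mul_le_mul_of_nonneg_right (le_max_left _ _) (hpos n hn).le)

theorem one_sub_div_rpow {m n : ℕ} (h : m < n) (s : ℝ) :
    (1 - (m : ℝ) / n) ^ s = ((n - m : ℕ) : ℝ) ^ s / (n : ℝ) ^ s := by
  have hn : (n : ℝ) ≠ 0 := by
    have : 0 < n := by omega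
    positivity
  rw [← Real.div_rpow (Nat.cast_nonneg _) (Nat.cast_nonneg _), Nat.cast_sub h.le, sub_div,
    div_self hn]

theorem one_sub_div_pos {m n : ℕ} (h : m < n) : 0 < 1 - (m : ℝ) / n := by
  have hn : (0 : ℝ) < n := by
    have : 0 < n := by omega
    positivity
  rw [sub_pos, div_lt_one hn]
  exact_mod_cast h

theorem exists_ratio_bounds (hθ : 0 < θ) :
    ∃ κ : ℝ, 1 ≤ κ ∧ ∀ m n : ℕ, m < n →
      risingCoeff θ (n - m) / risingCoeff θ n ≤ κ * (1 - (m : ℝ) / n) ^ (θ - 1) ∧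
      (1 - (m : ℝ) / n) ^ (θ - 1) ≤ κ * (risingCoeff θ (n - m) / risingCoeff θ n) := by
  obtain ⟨c, K, hc, hK, h⟩ := exists_risingCoeff_bounds hθ
  refine ⟨max 1 (K / c), le_max_left _ _, fun m n hmn => ?_⟩
  obtain ⟨h1, h2⟩ := h n (by omega)
  obtain ⟨h3, h4⟩ := h (n - m) (by omega)
  have hx : 0 < (n : ℝ) ^ (θ - 1) := Real.rpow_pos_of_pos (by norm_cast; omega) _
  have hy : 0 < ((n - m : ℕ) : ℝ) ^ (θ - 1) := Real.rpow_pos_of_pos (by norm_cast; omega) _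
  have ha := risingCoeff_pos hθ n
  have hb := risingCoeff_pos hθ (n - m)
  rw [one_sub_div_rpow hmn]
  constructor
  · calc _ ≤ (K * ((n - m : ℕ) : ℝ) ^ (θ - 1)) / (c * (n : ℝ) ^ (θ - 1)) := by gcongr
      _ = K / c * (((n - m : ℕ) : ℝ) ^ (θ - 1) / (n : ℝ) ^ (θ - 1)) := by field_simp
      _ ≤ _ := by gcongr; exact le_max_right _ _
  · calc _ ≤ (risingCoeff θ (n - m) / c) / (risingCoeff θ n / K) := by
          gcongr
          · rwa [le_div_iff₀' hc]
          · rwa [div_le_iff₀' hK]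
      _ = K / c * (risingCoeff θ (n - m) / risingCoeff θ n) := by field_simp
      _ ≤ _ := by gcongr; exact le_max_right _ _

/-- Both `n` and `n - m` are at least `N`, so the Cauchy property of a_k/k^{θ-1} applies to the
pair. The error is relative to the ratio, so that it can be summed against the moment itself. -/
theorem exists_abs_ratio_sub_le (hθ : 0 < θ) {ε : ℝ} (hε : 0 < ε) :
    ∃ N : ℕ, ∀ m n : ℕ, m < n → N ≤ n - m →
      |risingCoeff θ (n - m) / risingCoeff θ n - (1 - (m : ℝ) / n) ^ (θ - 1)| ≤
        ε * (risingCoeff θ (n - m) / risingCoeff θ n) := by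
  obtain ⟨c, K, hc, hK, h⟩ := exists_risingCoeff_bounds hθ
  obtain ⟨N, hN⟩ := Metric.cauchySeq_iff.1 (tendsto_risingCoeff_div_rpow hθ).cauchySeq (ε * c)
    (by positivity)
  refine ⟨N, fun m n hmn hNm => ?_⟩
  have hd := (hN n (by omega) (n - m) hNm).le
  have hx : 0 < (n : ℝ) ^ (θ - 1) := Real.rpow_pos_of_pos (by norm_cast; omega) _
  have hy : 0 < ((n - m : ℕ) : ℝ) ^ (θ - 1) := Real.rpow_pos_of_pos (by norm_cast; omega) _
  have ha := risingCoeff_pos hθ n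
  have hb := risingCoeff_pos hθ (n - m)
  rw [Real.dist_eq, abs_sub_comm] at hd
  rw [one_sub_div_rpow hmn]
  set a := risingCoeff θ n
  set b := risingCoeff θ (n - m)
  set x := (n : ℝ) ^ (θ - 1)
  set y := ((n - m : ℕ) : ℝ) ^ (θ - 1)
  have e : b / a - y / x = (b / y - a / x) * (y / a) := by
    field_simp
  rw [e, abs_mul, abs_of_pos (div_pos hy ha)]
  calc _ ≤ ε * c * (y / a) := by gcongr
    _ = ε * ((c * y) / a) := by ring
    _ ≤ ε * (b / a) := by gcongr; exact (h (n - m) (by omega)).1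

/-- The product is at least c·n^θ; this holds even for θ < 1, when a_n itself tends to 0. -/
theorem tendsto_mul_risingCoeff (hθ : 0 < θ) :
    Tendsto (fun n : ℕ => (n : ℝ) * risingCoeff θ n) atTop atTop := by
  obtain ⟨c, K, hc, hK, h⟩ := exists_risingCoeff_bounds hθ
  have h1 : Tendsto (fun n : ℕ => c * (n : ℝ) ^ θ) atTop atTop :=
    ((tendsto_rpow_atTop hθ).comp tendsto_natCast_atTop_atTop).const_mul_atTop hc
  refine tendsto_atTop_mono' _ ?_ h1
  filter_upwards [eventually_ge_atTop 1] with n hn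
  have hn' : (0 : ℝ) < n := by positivity
  calc c * (n : ℝ) ^ θ = n * (c * (n : ℝ) ^ (θ - 1)) := by
        rw [Real.rpow_sub_one hn'.ne']; field_simp
    _ ≤ _ := by gcongr; exact (h n hn).1

theorem exists_rpow_bounds (s : ℝ) :
    ∃ κ : ℝ, 1 ≤ κ ∧ ∀ x : ℝ, 1 / 2 ≤ x → x ≤ 1 → κ⁻¹ ≤ x ^ s ∧ x ^ s ≤ κ := by
  refine ⟨2 ^ |s|, Real.one_le_rpow (by norm_num) (abs_nonneg s), fun x hx hx1 => ?_⟩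
  have hx0 : 0 < x := by linarith
  have h : x⁻¹ ≤ 2 := by rw [inv_le_comm₀ hx0 (by norm_num)]; linarith
  have key (t : ℝ) : x ^ t ≤ 2 ^ |t| := by
    rcases le_total 0 t with ht | ht
    · exact (Real.rpow_le_one hx0.le hx1 ht).trans
        (Real.one_le_rpow (by norm_num) (abs_nonneg t))
    · rw [abs_of_nonpos ht]
      calc x ^ t = x⁻¹ ^ (-t) := by rw [Real.inv_rpow hx0.le, Real.rpow_neg hx0.le, inv_inv]
        _ ≤ _ := Real.rpow_le_rpow (by positivity) h (by linarith)
  refine ⟨?_, key s⟩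
  rw [inv_le_comm₀ (by positivity) (by positivity), ← Real.rpow_neg hx0.le]
  simpa using key (-s)

/-! ### Bounds on the moments and their comparison with `upsilon`. -/

/-- `E [w]_l / θ ^ l`, in closed form. -/
noncomputable def momentSum (θ : ℝ) (J : Finset ℕ) (n l : ℕ) : ℝ :=
  ∑ m ∈ Finset.range (n + 1), tupleWeight J l m * (risingCoeff θ (n - m) / risingCoeff θ n)

/-- At most `n` elements exceed n/2, each with reciprocal below 2/n. -/
theorem recipSum_filter_le {n : ℕ} {J : Finset ℕ} (hJ : J ⊆ Finset.Icc 1 n) :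
    recipSum J - 2 ≤ ∑ j ∈ J with 2 * j ≤ n, 1 / (j : ℝ) := by
  rw [recipSum, ← Finset.sum_filter_add_sum_filter_not J (2 * · ≤ n)]
  have : ∑ j ∈ J with ¬ 2 * j ≤ n, 1 / (j : ℝ) ≤ 2 := by
    rcases Nat.eq_zero_or_pos n with rfl | hn
    · have : J = ∅ := by simpa using hJ
      simp [this]
    have hn' : (0 : ℝ) < n := by positivity
    calc _ ≤ ∑ j ∈ J with ¬ 2 * j ≤ n, 2 / (n : ℝ) := by
          refine Finset.sum_le_sum fun j hj => ?_
          have h2 : n < 2 * j := not_le.1 (Finset.mem_filter.1 hj).2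
          have hj : (0 : ℝ) < j := by norm_cast; omega
          rw [div_le_div_iff₀ hj hn', one_mul]
          exact_mod_cast h2.le
      _ = ((J.filter fun j => ¬ 2 * j ≤ n).card : ℝ) * (2 / n) := by simp
      _ ≤ (n : ℝ) * (2 / n) := by
          gcongr
          calc _ ≤ J.card := Finset.card_filter_le _ _
            _ ≤ (Finset.Icc 1 n).card := Finset.card_le_card hJ
            _ = n := by simp
      _ = 2 := by field_simp
  linarith

theorem le_sum_tupleWeight_one_mul {n : ℕ} {J : Finset ℕ} (hJ : J ⊆ Finset.Icc 1 n)
    (s : Finset ℕ) (hs : Finset.range n ⊆ s) (f : ℕ → ℝ) (hf : ∀ m, m ∈ s → 0 ≤ f m) {c : ℝ}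
    (hc : 0 ≤ c) (hcf : ∀ m, 1 ≤ m → 2 * m ≤ n → c ≤ f m) :
    c * (recipSum J - 2) ≤ ∑ m ∈ s, tupleWeight J 1 m * f m := by
  calc c * (recipSum J - 2) ≤ c * ∑ j ∈ J with 2 * j ≤ n, 1 / (j : ℝ) := by
        gcongr; exact recipSum_filter_le hJ
    _ ≤ ∑ j ∈ J with 2 * j ≤ n, tupleWeight J 1 j * f j := by
        rw [Finset.mul_sum]
        refine Finset.sum_le_sum fun j hj => ?_
        obtain ⟨hj, hjn⟩ := Finset.mem_filter.1 hj
        rw [tupleWeight_one, if_pos hj, mul_comm]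
        gcongr
        exact hcf j (Finset.mem_Icc.1 (hJ hj)).1 hjn
    _ ≤ _ := by
        refine Finset.sum_le_sum_of_subset_of_nonneg (fun j hj => hs ?_) fun j hj _ =>
          mul_nonneg (tupleWeight_nonneg _ _ _) (hf j hj)
        obtain ⟨hj, hjn⟩ := Finset.mem_filter.1 hj
        have := (Finset.mem_Icc.1 (hJ hj)).1
        rw [Finset.mem_range]
        omega

theorem half_le_one_sub_div {m n : ℕ} (hn : 1 ≤ n) (h : 2 * m ≤ n) :
    1 / 2 ≤ 1 - (m : ℝ) / n ∧ 1 - (m : ℝ) / n ≤ 1 := by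
  have hn' : (0 : ℝ) < n := by positivity
  have h' : 2 * (m : ℝ) ≤ n := by exact_mod_cast h
  have h1 : (m : ℝ) / n ≤ 1 / 2 := by rw [div_le_iff₀ hn']; linarith
  have h2 : 0 ≤ (m : ℝ) / n := by positivity
  constructor <;> linarith

theorem exists_le_momentSum_one (hθ : 0 < θ) :
    ∃ c : ℝ, 0 < c ∧ ∀ (n : ℕ) (J : Finset ℕ), J ⊆ Finset.Icc 1 n →
      c * (recipSum J - 2) ≤ momentSum θ J n 1 := by
  obtain ⟨κ, hκ, h⟩ := exists_ratio_bounds hθ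
  obtain ⟨κ', hκ', h'⟩ := exists_rpow_bounds (θ - 1)
  refine ⟨κ⁻¹ * κ'⁻¹, by positivity, fun n J hJ => ?_⟩
  refine le_sum_tupleWeight_one_mul hJ _ (Finset.range_mono (Nat.le_succ n)) _ (fun m _ => ?_)
    (by positivity) fun m hm hmn => ?_
  · exact (div_pos (risingCoeff_pos hθ _) (risingCoeff_pos hθ _)).le
  · obtain ⟨h1, h2⟩ := half_le_one_sub_div (by omega) hmn
    rw [inv_mul_le_iff₀ (by positivity)]
    exact (h' _ h1 h2).1.trans (h m n (by omega)).2

theorem exists_le_upsilon_one (hθ : 0 < θ) :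
    ∃ c : ℝ, 0 < c ∧ ∀ (n : ℕ) (J : ℕ → Finset ℕ), J n ⊆ Finset.Icc 1 n →
      c * (recipSum (J n) - 2) ≤ upsilon θ J n 1 := by
  obtain ⟨κ', hκ', h'⟩ := exists_rpow_bounds (θ - 1)
  refine ⟨θ * κ'⁻¹, by positivity, fun n J hJ => ?_⟩
  rw [upsilon_eq, pow_one, mul_assoc]
  gcongr
  refine le_sum_tupleWeight_one_mul hJ _ subset_rfl _ (fun m hm => ?_)
    (by positivity) fun m hm hmn => ?_
  · exact (Real.rpow_pos_of_pos (one_sub_div_pos (Finset.mem_range.1 hm)) _).le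
  · obtain ⟨h1, h2⟩ := half_le_one_sub_div (by omega) hmn
    exact (h' _ h1 h2).1

/-- For m ≥ n/2 the decay of T_l gives T_l(m) ≤ 2lC^l/n, and the values n - m are distinct. -/
theorem sum_tupleWeight_mul_le {J : Finset ℕ} {C : ℝ} (hC : 1 ≤ C) (hJC : recipSum J ≤ C)
    {n l : ℕ} (hn : 1 ≤ n) (s : Finset ℕ) (hs : ∀ m ∈ s, m ≤ n ∧ n ≤ 2 * m) {f : ℕ → ℝ}
    (hf : ∀ k, 0 ≤ f k) {k : ℕ} (hsk : ∀ m ∈ s, n - m < k) :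
    ∑ m ∈ s, tupleWeight J l m * f (n - m) ≤
      2 * l * C ^ l / n * ∑ i ∈ Finset.range k, f i := by
  have hn' : (0 : ℝ) < n := by positivity
  calc _ ≤ ∑ m ∈ s, 2 * l * C ^ l / n * f (n - m) := by
        refine Finset.sum_le_sum fun m hm => ?_
        refine mul_le_mul_of_nonneg_right ?_ (hf _)
        rw [le_div_iff₀ hn']
        have h1 := mul_tupleWeight_le hC hJC l m
        have h2 : (n : ℝ) ≤ 2 * m := by exact_mod_cast (hs m hm).2
        have h3 := mul_le_mul_of_nonneg_right h2 (tupleWeight_nonneg J l m)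
        linarith
    _ = 2 * l * C ^ l / n * ∑ i ∈ s.image (n - ·), f i := by
        rw [← Finset.mul_sum, Finset.sum_image]
        intro a ha b hb hab
        have := (hs a ha).1
        have := (hs b hb).1
        simp only at hab
        omega
    _ ≤ _ := by
        refine mul_le_mul_of_nonneg_left
          (Finset.sum_le_sum_of_subset_of_nonneg (fun i hi => ?_) fun i _ _ => hf i)
          (by positivity)
        obtain ⟨m, hm, rfl⟩ := Finset.mem_image.1 hi
        exact Finset.mem_range.2 (hsk m hm)

/-- For m ≤ n/2 the ratio is bounded; for m > n/2, T_l(m) = O(lC^l/n) and ∑_{k≤n} a_k = (n +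
θ)a_n/θ. `A` does not depend on `C` or `l`: this permits C = D_n unbounded in the tightness
argument, and makes the bounds summable in `l` after division by l!. -/
theorem exists_momentSum_le (hθ : 0 < θ) :
    ∃ A : ℝ, 0 < A ∧ ∀ (n : ℕ) (J : Finset ℕ) (C : ℝ), 1 ≤ C → recipSum J ≤ C →
      ∀ l : ℕ, momentSum θ J n l ≤ A * (l + 1) * C ^ l := by
  obtain ⟨κ, hκ, h⟩ := exists_ratio_bounds hθ
  obtain ⟨κ', hκ', h'⟩ := exists_rpow_bounds (θ - 1)
  refine ⟨κ * κ' + 2 * (1 + θ) / θ, by positivity, fun n J C hC hJC l => ?_⟩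
  rcases Nat.eq_zero_or_pos n with rfl | hn
  · have h0 : 0 ≤ recipSum J := Finset.sum_nonneg fun _ _ => by positivity
    have h1 := (sum_tupleWeight_le J {0} l).trans (pow_le_pow_left₀ h0 hJC l)
    have hA : 1 ≤ (κ * κ' + 2 * (1 + θ) / θ) * (l + 1) := by
      have h2 : 0 ≤ 2 * (1 + θ) / θ := by positivity
      have h3 : (1 : ℝ) ≤ l + 1 := by linarith [Nat.cast_nonneg (α := ℝ) l]
      nlinarith [one_le_mul_of_one_le_of_one_le hκ hκ']
    rw [momentSum, zero_add, Finset.sum_range_one, div_self (risingCoeff_pos hθ _).ne', mul_one]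
    rw [Finset.sum_singleton] at h1
    exact h1.trans (le_mul_of_one_le_left (by positivity) hA)
  have hn' : (1 : ℝ) ≤ n := by exact_mod_cast hn
  have h0 : 0 ≤ recipSum J := Finset.sum_nonneg fun _ _ => by positivity
  have ha := risingCoeff_pos hθ n
  rw [momentSum, ← Finset.sum_filter_add_sum_filter_not _ (2 * · ≤ n)]
  have h1 : ∑ m ∈ Finset.range (n + 1) with 2 * m ≤ n,
      tupleWeight J l m * (risingCoeff θ (n - m) / risingCoeff θ n) ≤ κ * κ' * C ^ l := by
    calc _ ≤ ∑ m ∈ Finset.range (n + 1) with 2 * m ≤ n, tupleWeight J l m * (κ * κ') := by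
          refine Finset.sum_le_sum fun m hm => ?_
          have hm := (Finset.mem_filter.1 hm).2
          refine mul_le_mul_of_nonneg_left ?_ (tupleWeight_nonneg _ _ _)
          obtain ⟨h1, h2⟩ := half_le_one_sub_div hn hm
          refine (h m n (by omega)).1.trans ?_
          gcongr
          exact (h' _ h1 h2).2
      _ ≤ recipSum J ^ l * (κ * κ') := by
          rw [← Finset.sum_mul]
          gcongr
          exact sum_tupleWeight_le _ _ _
      _ ≤ _ := by rw [mul_comm]; gcongr
  have h2 : ∑ m ∈ Finset.range (n + 1) with ¬ 2 * m ≤ n,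
      tupleWeight J l m * (risingCoeff θ (n - m) / risingCoeff θ n) ≤
        2 * (1 + θ) / θ * l * C ^ l := by
    refine (sum_tupleWeight_mul_le hC hJC hn _ (fun m hm => ?_)
      (f := fun k => risingCoeff θ k / risingCoeff θ n)
      (fun k => (div_pos (risingCoeff_pos hθ _) ha).le) (k := n + 1) (fun m _ => by omega)).trans ?_
    · have := Finset.mem_filter.1 hm
      have := Finset.mem_range.1 this.1
      omega
    · have hsum : ∑ k ∈ Finset.range (n + 1), risingCoeff θ k =
          (n + θ) / θ * risingCoeff θ n := by
        rw [Finset.sum_range_succ]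
        have := mul_sum_risingCoeff θ n
        field_simp
        linarith
      rw [← Finset.sum_div, hsum, mul_div_cancel_right₀ _ ha.ne']
      calc 2 * l * C ^ l / n * ((n + θ) / θ) ≤ 2 * l * C ^ l / n * ((n + n * θ) / θ) := by
            gcongr
            nlinarith
        _ = _ := by field_simp
  have h3 : 0 ≤ C ^ l := by positivity
  have h4 : κ * κ' * C ^ l ≤ κ * κ' * (l + 1) * C ^ l := by
    have : 0 ≤ κ * κ' * l * C ^ l := by positivity
    linarith
  have h5 : 2 * (1 + θ) / θ * l * C ^ l ≤ 2 * (1 + θ) / θ * (l + 1) * C ^ l := by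
    gcongr
    linarith
  linarith

theorem tendsto_momentSum_sub (hθ : 0 < θ) (J : ℕ → Finset ℕ) {C : ℝ} (hC : 1 ≤ C)
    (hJC : ∀ n, recipSum (J n) ≤ C) (l : ℕ) :
    Tendsto (fun n => momentSum θ (J n) n l - ∑ m ∈ Finset.range n,
      tupleWeight (J n) l m * (1 - (m : ℝ) / n) ^ (θ - 1)) atTop (𝓝 0) := by
  obtain ⟨κ, hκ, hκ'⟩ := exists_ratio_bounds hθ
  obtain ⟨A, hA, hA'⟩ := exists_momentSum_le hθ
  set B := A * (l + 1) * C ^ l with hB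
  have hBpos : 0 < B := by positivity
  rw [Metric.tendsto_atTop']
  intro ε hε
  obtain ⟨N, hN⟩ := exists_abs_ratio_sub_le hθ (ε := ε / (2 * B)) (by positivity)
  have hlim : Tendsto (fun n : ℕ => (1 + κ) * (2 * l * C ^ l *
      ∑ k ∈ Finset.range (N + 1), risingCoeff θ k) / (n * risingCoeff θ n)) atTop (𝓝 0) :=
    (tendsto_mul_risingCoeff hθ).const_div_atTop _
  obtain ⟨M, hM⟩ := eventually_atTop.1 (hlim.eventually_lt_const (half_pos hε))
  -- With n > 2N + 1, every m with n - m ≤ N satisfies 2m ≥ n, as the O(1/n) bound requires.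
  refine ⟨max M (2 * N + 1), fun n hn => ?_⟩
  have hn1 : M < n := (le_max_left _ _).trans_lt hn
  have hn2 : 2 * N + 1 < n := (le_max_right _ _).trans_lt hn
  have ha := risingCoeff_pos hθ n
  have hψ (m : ℕ) : 0 < risingCoeff θ (n - m) / risingCoeff θ n :=
    div_pos (risingCoeff_pos hθ _) ha
  rw [dist_zero_right, Real.norm_eq_abs]
  -- The moment has a term m = n that `upsilon` lacks; extending by 0 puts both sums on the same
  -- range.
  set x : ℕ → ℝ := fun m => if m < n then (1 - (m : ℝ) / n) ^ (θ - 1) else 0 with hx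
  have hxs : ∑ m ∈ Finset.range n, tupleWeight (J n) l m * (1 - (m : ℝ) / n) ^ (θ - 1) =
      ∑ m ∈ Finset.range (n + 1), tupleWeight (J n) l m * x m := by
    rw [Finset.sum_range_succ]
    simp only [hx, lt_irrefl, if_false, mul_zero, add_zero]
    exact Finset.sum_congr rfl fun m hm => by rw [if_pos (Finset.mem_range.1 hm)]
  rw [hxs, momentSum, ← Finset.sum_sub_distrib]
  refine (Finset.abs_sum_le_sum_abs _ _).trans_lt ?_
  simp only [← mul_sub, abs_mul, abs_of_nonneg (tupleWeight_nonneg (J n) l _)]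
  rw [← Finset.sum_filter_add_sum_filter_not _ (N < n - ·)]
  have h1 : ∑ m ∈ Finset.range (n + 1) with N < n - m, tupleWeight (J n) l m *
      |risingCoeff θ (n - m) / risingCoeff θ n - x m| ≤ ε / 2 := by
    calc _ ≤ ∑ m ∈ Finset.range (n + 1) with N < n - m, ε / (2 * B) *
          (tupleWeight (J n) l m * (risingCoeff θ (n - m) / risingCoeff θ n)) := by
          refine Finset.sum_le_sum fun m hm => ?_
          have hm := (Finset.mem_filter.1 hm).2
          have hmn : m < n := by omega
          rw [mul_left_comm]
          refine mul_le_mul_of_nonneg_left ?_ (tupleWeight_nonneg _ _ _)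
          simp only [hx, if_pos hmn]
          exact hN m n hmn hm.le
      _ ≤ ε / (2 * B) * momentSum θ (J n) n l := by
          rw [← Finset.mul_sum]
          gcongr
          refine Finset.sum_le_sum_of_subset_of_nonneg (Finset.filter_subset _ _) fun m _ _ =>
            mul_nonneg (tupleWeight_nonneg _ _ _) (hψ m).le
      _ ≤ ε / (2 * B) * B := by
          gcongr
          exact hA' n (J n) C hC (hJC n) l
      _ = ε / 2 := by field_simp
  have h2 : ∑ m ∈ Finset.range (n + 1) with ¬ N < n - m, tupleWeight (J n) l m *
      |risingCoeff θ (n - m) / risingCoeff θ n - x m| < ε / 2 := by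
    refine lt_of_le_of_lt ?_ (hM n hn1.le)
    calc _ ≤ ∑ m ∈ Finset.range (n + 1) with ¬ N < n - m, (1 + κ) * (tupleWeight (J n) l m *
          (risingCoeff θ (n - m) / risingCoeff θ n)) := by
          refine Finset.sum_le_sum fun m hm => ?_
          rw [mul_left_comm]
          refine mul_le_mul_of_nonneg_left ?_ (tupleWeight_nonneg _ _ _)
          have hp := hψ m
          by_cases hmn : m < n
          · simp only [hx, if_pos hmn]
            have := (hκ' m n hmn).2
            have := Real.rpow_pos_of_pos (one_sub_div_pos hmn) (θ - 1)
            rw [abs_le]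
            constructor <;> nlinarith
          · simp only [hx, if_neg hmn, sub_zero, abs_of_pos hp]
            nlinarith
      _ ≤ (1 + κ) * (2 * l * C ^ l / n * ∑ k ∈ Finset.range (N + 1),
          risingCoeff θ k / risingCoeff θ n) := by
          rw [← Finset.mul_sum]
          gcongr
          refine sum_tupleWeight_mul_le hC (hJC n) (by omega) _ (fun m hm => ?_)
            (f := fun k => risingCoeff θ k / risingCoeff θ n)
            (fun k => (div_pos (risingCoeff_pos hθ _) ha).le) (fun m hm => ?_)
          · have := Finset.mem_filter.1 hm
            have := Finset.mem_range.1 this.1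
            omega
          · have := (Finset.mem_filter.1 hm).2
            omega
      _ = _ := by
          rw [← Finset.sum_div]
          have : (n : ℝ) ≠ 0 := by norm_cast; omega
          field_simp
  linarith

/-! ### Inclusion-exclusion and the method of moments on ℕ. -/

theorem sum_neg_one_pow_mul_choose_mul_choose (j k : ℕ) :
    ∑ l ∈ Finset.range (j + 1), (-1 : ℝ) ^ (l + k) * l.choose k * j.choose l =
      if j = k then 1 else 0 := by
  rcases lt_or_ge j k with hjk | hjk
  · rw [if_neg hjk.ne]
    refine Finset.sum_eq_zero fun l hl => ?_
    rw [Nat.choose_eq_zero_of_lt (by have := Finset.mem_range.1 hl; omega)]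
    simp
  · obtain ⟨d, rfl⟩ := Nat.exists_eq_add_of_le hjk
    rw [add_assoc, Finset.sum_range_add, Finset.sum_eq_zero, zero_add]
    · have h (i : ℕ) : (-1 : ℝ) ^ (k + i + k) * (k + i).choose k * (k + d).choose (k + i) =
          (k + d).choose k * (((-1 : ℤ) ^ i * (d.choose i : ℤ) : ℤ) : ℝ) := by
        have h1 := Nat.choose_mul (n := k + d) (k := k + i) (s := k) (by omega)
        rw [Nat.add_sub_cancel_left, Nat.add_sub_cancel_left] at h1
        have h2 : ((k + d).choose (k + i) : ℝ) * (k + i).choose k =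
          (k + d).choose k * d.choose i := by exact_mod_cast h1
        rw [show k + i + k = i + 2 * k by ring, pow_add, pow_mul]
        push_cast
        linear_combination (-1 : ℝ) ^ i * h2
      simp only [h]
      rw [← Finset.mul_sum, ← Int.cast_sum, Int.alternating_sum_range_choose]
      rcases Nat.eq_zero_or_pos d with rfl | hd
      · simp
      · rw [if_neg hd.ne', if_neg (by omega)]
        simp
    · intro l hl
      rw [Nat.choose_eq_zero_of_lt (Finset.mem_range.1 hl)]
      simp

/-- The inclusion-exclusion formula: a sequence is recovered from its binomial moments. -/
theorem hasSum_inversion {q c : ℕ → ℝ} (hq : ∀ k, 0 ≤ q k)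
    (h : ∀ l, HasSum (fun j => q j * (j.choose l : ℝ)) (c l))
    (hc : Summable fun l => 2 ^ l * c l) (k : ℕ) :
    HasSum (fun l => (-1 : ℝ) ^ (l + k) * l.choose k * c l) (q k) := by
  have hc0 (l : ℕ) : 0 ≤ c l := (h l).nonneg fun j => mul_nonneg (hq j) (Nat.cast_nonneg _)
  set F : ℕ × ℕ → ℝ := fun x => (-1 : ℝ) ^ (x.1 + k) * x.1.choose k * (q x.2 * x.2.choose x.1)
    with hFdef
  -- Absolute summability allows exchanging the sums; the absolute sum over `j` is C(l,k)·c_l ≤ 2^l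
  -- c_l, whence the factor 2^l in `hc`.
  have hF : Summable F := by
    refine Summable.of_norm ?_
    have hn : (fun x => ‖F x‖) = fun x : ℕ × ℕ =>
        (x.1.choose k : ℝ) * (q x.2 * x.2.choose x.1) := by
      ext x
      have : 0 ≤ q x.2 * (x.2.choose x.1 : ℝ) := mul_nonneg (hq _) (Nat.cast_nonneg _)
      simp [hFdef, abs_of_nonneg (hq x.2)]
    rw [hn, summable_prod_of_nonneg fun x =>
      mul_nonneg (Nat.cast_nonneg _) (mul_nonneg (hq _) (Nat.cast_nonneg _))]
    have hl (l : ℕ) : HasSum (fun j => (l.choose k : ℝ) * (q j * j.choose l))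
        (l.choose k * c l) := (h l).mul_left _
    refine ⟨fun l => (hl l).summable, ?_⟩
    simp only [fun l => (hl l).tsum_eq]
    refine Summable.of_nonneg_of_le (fun l => mul_nonneg (Nat.cast_nonneg _) (hc0 l))
      (fun l => mul_le_mul_of_nonneg_right ?_ (hc0 l)) hc
    exact_mod_cast Nat.choose_le_two_pow l k
  have h1' (l : ℕ) : HasSum (fun j => F (l, j)) ((-1 : ℝ) ^ (l + k) * l.choose k * c l) :=
    (h l).mul_left _
  have h1 : HasSum (fun l => (-1 : ℝ) ^ (l + k) * l.choose k * c l) (∑' x, F x) :=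
    hF.hasSum.prod_fiberwise h1'
  have h2 : ∀ j, HasSum (fun l => F (l, j)) (if j = k then q j else 0) := by
    intro j
    have : (if j = k then q j else 0) = ∑ l ∈ Finset.range (j + 1), F (l, j) := by
      have := sum_neg_one_pow_mul_choose_mul_choose j k
      calc _ = q j * ∑ l ∈ Finset.range (j + 1), (-1 : ℝ) ^ (l + k) * l.choose k * j.choose l := by
            rw [this]; simp
        _ = _ := by
            rw [Finset.mul_sum]
            exact Finset.sum_congr rfl fun l _ => by simp only [hFdef]; ring
    rw [this]
    refine hasSum_sum_of_ne_finset_zero fun l hl => ?_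
    simp only [hFdef]
    rw [Nat.choose_eq_zero_of_lt (n := j) (k := l) (by simpa using hl)]
    simp
  have h3 : HasSum (fun j => if j = k then q j else 0) (∑' x, F x) :=
    HasSum.prod_fiberwise (f := fun x : ℕ × ℕ => F (x.2, x.1))
      ((Equiv.prodComm ℕ ℕ).hasSum_iff.2 hF.hasSum) h2
  have h4 : HasSum (fun j => if j = k then q j else 0) (q k) := by
    convert! hasSum_ite_eq k (q k) using 2 with j
    split_ifs with hj
    · rw [hj]
    · rfl
  rwa [h3.unique h4] at h1

/-- A Markov bound: for k ≥ l + K + 1 the next factorial power is [k]_l (k - l) ≥ (K + 1)[k]_l. -/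
theorem sum_range_moment_le {q : ℕ → ℝ} (hq : ∀ k, 0 ≤ q k) {l : ℕ} {a b : ℝ}
    (ha : HasSum (fun k => q k * (k.descFactorial l : ℝ)) a)
    (hb : HasSum (fun k => q k * (k.descFactorial (l + 1) : ℝ)) b) (K : ℕ) :
    |a - ∑ k ∈ Finset.range (l + K + 1), q k * (k.descFactorial l : ℝ)| ≤ b / (K + 1) := by
  have hK : (0 : ℝ) < K + 1 := by positivity
  have h1 := (hasSum_nat_add_iff' (l + K + 1)).2 ha
  have h2 := ((hasSum_nat_add_iff' (l + K + 1)).2 hb).div_const ((K : ℝ) + 1)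
  rw [abs_of_nonneg (h1.nonneg fun k => mul_nonneg (hq _) (Nat.cast_nonneg _))]
  refine (hasSum_le (fun k => ?_) h1 h2).trans ?_
  · rw [le_div_iff₀ hK, mul_assoc, Nat.descFactorial_succ]
    refine mul_le_mul_of_nonneg_left ?_ (hq _)
    rw [mul_comm, Nat.cast_mul]
    gcongr
    have : K + 1 ≤ k + (l + K + 1) - l := by omega
    exact_mod_cast this
  · gcongr
    have := Finset.sum_nonneg fun k (_ : k ∈ Finset.range (l + K + 1)) =>
      mul_nonneg (hq k) (Nat.cast_nonneg (α := ℝ) (k.descFactorial (l + 1)))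
    linarith

/-- Pointwise convergence with bounded factorial moments implies convergence of the moments. -/
theorem tendsto_moment {q : ℕ → ℕ → ℝ} {p : ℕ → ℝ} {M : ℕ → ℕ → ℝ} {B : ℕ → ℝ}
    (hq : ∀ n k, 0 ≤ q n k) (hqp : ∀ k, Tendsto (fun n => q n k) atTop (𝓝 (p k)))
    (hM : ∀ n l, HasSum (fun k => q n k * (k.descFactorial l : ℝ)) (M n l))
    (hB : ∀ n l, M n l ≤ B l) (l : ℕ) :
    ∃ m, HasSum (fun k => p k * (k.descFactorial l : ℝ)) m ∧
      Tendsto (fun n => M n l) atTop (𝓝 m) := by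
  have hp (k : ℕ) : 0 ≤ p k := ge_of_tendsto' (hqp k) fun n => hq n k
  have hfin (l K : ℕ) : Tendsto (fun n => ∑ k ∈ Finset.range K, q n k * (k.descFactorial l : ℝ))
      atTop (𝓝 (∑ k ∈ Finset.range K, p k * (k.descFactorial l : ℝ))) :=
    tendsto_finsetSum _ fun k _ => (hqp k).mul_const _
  have hle (l K : ℕ) : ∑ k ∈ Finset.range K, p k * (k.descFactorial l : ℝ) ≤ B l :=
    le_of_tendsto' (hfin l K) fun n => (sum_le_hasSum _ (fun k _ =>
      mul_nonneg (hq n k) (Nat.cast_nonneg _)) (hM n l)).trans (hB n l)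
  have hs (l : ℕ) : Summable fun k => p k * (k.descFactorial l : ℝ) :=
    summable_of_sum_range_le (fun k => mul_nonneg (hp k) (Nat.cast_nonneg _)) (hle l)
  have hsB (l : ℕ) : ∑' k, p k * (k.descFactorial l : ℝ) ≤ B l :=
    (hs l).tsum_le_of_sum_range_le (hle l)
  refine ⟨_, (hs l).hasSum, Metric.tendsto_atTop'.2 fun ε hε => ?_⟩
  -- This `K` makes the tails of all the laws and of the limit smaller than ε/3 at once.
  obtain ⟨K, hK⟩ := exists_nat_gt (3 * B (l + 1) / ε)
  have hK' : B (l + 1) / (K + 1) < ε / 3 := by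
    rw [div_lt_iff₀ hε] at hK
    rw [div_lt_iff₀ (by positivity)]
    linarith
  obtain ⟨N, hN⟩ := Metric.tendsto_atTop'.1 (hfin l (l + K + 1)) (ε / 3) (by positivity)
  refine ⟨N, fun n hn => ?_⟩
  have h1 := hN n hn
  have h2 := (sum_range_moment_le (hq n) (hM n l) (hM n (l + 1)) K).trans
    (div_le_div_of_nonneg_right (hB n (l + 1)) (by positivity))
  have h3 := (sum_range_moment_le hp (hs l).hasSum (hs (l + 1)).hasSum K).trans
    (div_le_div_of_nonneg_right (hsB (l + 1)) (by positivity))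
  rw [Real.dist_eq] at h1 ⊢
  rw [abs_lt] at h1 ⊢
  rw [abs_le] at h2 h3
  constructor <;> linarith

/-- Convergence of factorial moments with controlled growth implies pointwise convergence. -/
theorem tendsto_of_tendsto_moment {q : ℕ → ℕ → ℝ} {M : ℕ → ℕ → ℝ} {B m : ℕ → ℝ}
    (hq : ∀ n k, 0 ≤ q n k)
    (hM : ∀ n l, HasSum (fun k => q n k * (k.descFactorial l : ℝ)) (M n l))
    (hB : ∀ n l, M n l ≤ B l) (hBs : Summable fun l => 2 ^ l * (B l / l !))
    (hm : ∀ l, Tendsto (fun n => M n l) atTop (𝓝 (m l))) (k : ℕ) :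
    Tendsto (fun n => q n k) atTop
      (𝓝 (∑' l : ℕ, (-1 : ℝ) ^ (l + k) * l.choose k * (m l / l !))) := by
  have hM0 (n l : ℕ) : 0 ≤ M n l := (hM n l).nonneg fun k => mul_nonneg (hq n k) (Nat.cast_nonneg _)
  have hsn (n : ℕ) : Summable fun l => 2 ^ l * (M n l / l !) := by
    refine Summable.of_nonneg_of_le (fun l => ?_) (fun l => ?_) hBs
    · have := hM0 n l; positivity
    · have := hB n l; gcongr
  have hc (n l : ℕ) : HasSum (fun j => q n j * (j.choose l : ℝ)) (M n l / l !) := by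
    have hl : (l ! : ℝ) ≠ 0 := by positivity
    have h := (hM n l).div_const (l ! : ℝ)
    simp only [Nat.descFactorial_eq_factorial_mul_choose, Nat.cast_mul] at h
    convert! h using 2 with j
    field_simp
  have hinv (n : ℕ) := hasSum_inversion (hq n) (hc n) (hsn n) k
  simp only [← (hinv _).tsum_eq]
  -- Since C(l,k) ≤ 2^l, the inversion series is dominated uniformly in `n` by 2^l B_l / l!.
  refine tendsto_tsum_of_dominated_convergence hBs (fun l => ?_) (.of_forall fun n l => ?_)
  · exact ((hm l).div_const _).const_mul _
  · have := hM0 n l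
    rw [norm_mul, norm_mul, norm_pow, norm_neg, norm_one, one_pow, one_mul,
      Real.norm_of_nonneg (Nat.cast_nonneg _), Real.norm_of_nonneg (by positivity)]
    have := hB n l
    gcongr
    exact_mod_cast Nat.choose_le_two_pow l k

/-- A law on `ℕ` whose factorial moments have controlled growth is determined by them. -/
theorem eq_tsum_of_hasSum_moment {p B m : ℕ → ℝ} (hp : ∀ k, 0 ≤ p k)
    (hm : ∀ l, HasSum (fun k => p k * (k.descFactorial l : ℝ)) (m l))
    (hB : ∀ l, m l ≤ B l) (hBs : Summable fun l => 2 ^ l * (B l / l !)) (k : ℕ) :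
    p k = ∑' l : ℕ, (-1 : ℝ) ^ (l + k) * l.choose k * (m l / l !) :=
  tendsto_nhds_unique tendsto_const_nhds (tendsto_of_tendsto_moment (fun _ => hp) (fun _ => hm)
    (fun _ => hB) hBs (fun _ => tendsto_const_nhds) k)

/-- A tightness estimate in place of Cauchy–Schwarz: below `K` use k ≤ K, and from `K` on use k ≤
tk² + 1/(4t) with mass at most δ there; also k² = [k]_2 + [k]_1. -/
theorem moment_one_le {q : ℕ → ℝ} (hq : ∀ k, 0 ≤ q k) {M : ℕ → ℝ} (hM0 : M 0 = 1)
    (hM : ∀ l, HasSum (fun k => q k * (k.descFactorial l : ℝ)) (M l)) {δ t : ℝ} (ht : 0 < t)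
    {K : ℕ} (hK : 1 - δ ≤ ∑ k ∈ Finset.range K, q k) :
    M 1 ≤ K + t * (M 2 + M 1) + δ / (4 * t) := by
  have h0 : HasSum q 1 := by simpa [hM0] using hM 0
  have h1 : HasSum (fun k => if k < K then q k else 0) (∑ k ∈ Finset.range K, q k) := by
    have : ∑ k ∈ Finset.range K, q k = ∑ k ∈ Finset.range K, if k < K then q k else 0 :=
      Finset.sum_congr rfl fun k hk => by rw [if_pos (Finset.mem_range.1 hk)]
    rw [this]
    refine hasSum_sum_of_ne_finset_zero fun k hk => ?_
    rw [if_neg (by simpa using hk)]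
  have h2 := ((h0.mul_right (K : ℝ)).add (((hM 2).add (hM 1)).mul_left t)).add
    ((h0.sub h1).div_const (4 * t))
  have h3 := hasSum_le (fun k => ?_) (hM 1) h2
  · refine h3.trans ?_
    have : (1 - ∑ k ∈ Finset.range K, q k) / (4 * t) ≤ δ / (4 * t) := by
      gcongr; linarith
    linarith
  · have e : (k.descFactorial 2 : ℝ) + k.descFactorial 1 = (k : ℝ) ^ 2 := by
      rcases k with _ | k
      · simp
      · simp [Nat.descFactorial_succ]; ring
    rw [← mul_add, e, Nat.descFactorial_one]
    have hk := hq k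
    split_ifs with hkK
    · have : (k : ℝ) ≤ K := by exact_mod_cast hkK.le
      have h5 := mul_le_mul_of_nonneg_left this hk
      have h6 : 0 ≤ t * (q k * (k : ℝ) ^ 2) := by positivity
      simpa using h5.trans (le_add_of_nonneg_right h6)
    · have h5 : (k : ℝ) ≤ t * (k : ℝ) ^ 2 + 1 / (4 * t) := by
        have : t * (k : ℝ) ^ 2 + 1 / (4 * t) - k = (2 * t * k - 1) ^ 2 / (4 * t) := by
          field_simp; ring
        have h6 : 0 ≤ (2 * t * (k : ℝ) - 1) ^ 2 / (4 * t) := by positivity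
        linarith
      have h6 := mul_le_mul_of_nonneg_left h5 hk
      have h7 : 0 ≤ q k * (K : ℝ) := by positivity
      rw [sub_zero]
      calc _ ≤ _ := h6
        _ = t * (q k * (k : ℝ) ^ 2) + q k / (4 * t) := by ring
        _ ≤ _ := by linarith

/-! ### Laws on ℕ as sequences of point masses. -/

theorem integrable_and_integral_eq_iff {μ : Measure ℕ} [IsProbabilityMeasure μ] {f : ℕ → ℝ}
    (hf : ∀ k, 0 ≤ f k) {c : ℝ} :
    (Integrable f μ ∧ ∫ k, f k ∂μ = c) ↔ HasSum (fun k => μ.real {k} * f k) c := by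
  have h : Integrable f μ ↔ Summable fun k => μ.real {k} * f k := by
    conv_lhs => rw [← Measure.sum_smul_dirac μ]
    rw [integrable_sum_dirac_iff fun k => measure_ne_top _ _]
    simp only [Real.norm_of_nonneg (hf _), measureReal_def]
  constructor
  · rintro ⟨h1, rfl⟩
    rw [integral_countable h1]
    exact (h.1 h1).hasSum
  · intro hs
    refine ⟨h.2 hs.summable, ?_⟩
    rw [integral_countable (h.2 hs.summable)]
    exact hs.tsum_eq

theorem exists_probabilityMeasure_real_eq {p : ℕ → ℝ} (hp : ∀ k, 0 ≤ p k) (h1 : HasSum p 1) :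
    ∃ μ : Measure ℕ, IsProbabilityMeasure μ ∧ ∀ k, μ.real {k} = p k := by
  have h : HasSum (fun k => ENNReal.ofReal (p k)) 1 := by
    have := ENNReal.ofReal_tsum_of_nonneg hp h1.summable
    rw [h1.tsum_eq, ENNReal.ofReal_one] at this
    rw [this]
    exact ENNReal.summable.hasSum
  let P : PMF ℕ := ⟨fun k => ENNReal.ofReal (p k), h⟩
  refine ⟨P.toMeasure, inferInstance, fun k => ?_⟩
  rw [measureReal_def, P.toMeasure_apply_singleton k (measurableSet_singleton k)]
  exact ENNReal.toReal_ofReal (hp k)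

theorem lawDistFun_eq (μ : Measure ℕ) [IsProbabilityMeasure μ] (x : ℝ) :
    lawDistFun μ x = ∑ k ∈ Finset.range ⌈x⌉₊, μ.real {k} := by
  rw [lawDistFun, sum_measureReal_singleton]
  congr 1
  ext k
  simp [Nat.lt_ceil]

/-- `⌈x⌉₊` is constant on (K - 1, K). Weak convergence at these points yields the partial sums and,
by differences, the point masses. -/
theorem continuousAt_sum_range_ceil (p : ℕ → ℝ) (K : ℕ) :
    ContinuousAt (fun x : ℝ => ∑ k ∈ Finset.range ⌈x⌉₊, p k) (K - 1 / 2) := by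
  have : (fun x : ℝ => ∑ k ∈ Finset.range ⌈x⌉₊, p k) =ᶠ[𝓝 ((K : ℝ) - 1 / 2)]
      fun _ => ∑ k ∈ Finset.range K, p k := by
    filter_upwards [Ioo_mem_nhds (a := (K : ℝ) - 1) (b := K) (by linarith) (by linarith)]
      with x hx
    congr 2
    rcases Nat.eq_zero_or_pos K with rfl | hK
    · rw [Nat.ceil_eq_zero]
      simpa using hx.2.le
    · rw [Nat.ceil_eq_iff hK.ne', Nat.cast_sub hK, Nat.cast_one]
      exact ⟨hx.1, hx.2.le⟩
  exact continuousAt_const.congr this.symm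

theorem weakConv_iff {q : ℕ → ℕ → ℝ} (μ : Measure ℕ) [IsProbabilityMeasure μ] :
    WeakConv (fun n x => ∑ k ∈ Finset.range ⌈x⌉₊, q n k) (lawDistFun μ) ↔
      ∀ k, Tendsto (fun n => q n k) atTop (𝓝 (μ.real {k})) := by
  have hμ : lawDistFun μ = fun x => ∑ k ∈ Finset.range ⌈x⌉₊, μ.real {k} :=
    funext (lawDistFun_eq μ)
  rw [hμ]
  constructor
  · intro h k
    have hK (K : ℕ) : Tendsto (fun n => ∑ k ∈ Finset.range K, q n k) atTop
        (𝓝 (∑ k ∈ Finset.range K, μ.real {k})) := by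
      have hc : ⌈(K : ℝ) - 1 / 2⌉₊ = K := by
        rcases Nat.eq_zero_or_pos K with rfl | hK
        · rw [Nat.ceil_eq_zero]; norm_num
        · rw [Nat.ceil_eq_iff hK.ne', Nat.cast_sub hK, Nat.cast_one]
          constructor <;> linarith
      have := h _ (continuousAt_sum_range_ceil (fun k => μ.real {k}) K)
      simpa only [hc] using this
    simpa only [Finset.sum_range_succ, add_sub_cancel_left] using (hK (k + 1)).sub (hK k)
  · intro h x _
    exact tendsto_finsetSum _ fun k _ => h k

/-! ### The moment method applied to the Ewens laws. -/

/-- The Ewens probability that a permutation has exactly `k` cycles with lengths in `J`. -/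
noncomputable def cycleProb (θ : ℝ) (J : Finset ℕ) (n k : ℕ) : ℝ :=
  ∑ σ : Equiv.Perm (Fin n),
    θ ^ totalCycles σ / risingFactorial θ n * if k = cyclesIn σ J then 1 else 0

theorem cycleProb_nonneg (hθ : 0 < θ) (J : Finset ℕ) (n k : ℕ) : 0 ≤ cycleProb θ J n k := by
  have : 0 < risingFactorial θ n := Finset.prod_pos fun i _ => by positivity
  refine Finset.sum_nonneg fun σ _ => mul_nonneg (by positivity) ?_
  split_ifs <;> norm_num

theorem cycleDistFun_eq (J : ℕ → Finset ℕ) :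
    cycleDistFun θ J = fun n x => ∑ k ∈ Finset.range ⌈x⌉₊, cycleProb θ (J n) n k := by
  funext n x
  simp only [cycleProb]
  rw [Finset.sum_comm, cycleDistFun, ewensProb, Finset.sum_filter]
  refine Finset.sum_congr rfl fun σ _ => ?_
  rw [← Finset.mul_sum, Finset.sum_ite_eq']
  simp [Nat.lt_ceil]

theorem hasSum_cycleProb (hθ : 0 < θ) {J : Finset ℕ} (hJ : 0 ∉ J) (n l : ℕ) :
    HasSum (fun k => cycleProb θ J n k * (k.descFactorial l : ℝ)) (θ ^ l * momentSum θ J n l) := by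
  rw [momentSum, ← sum_descFactorial_cyclesIn θ hθ hJ]
  simp only [cycleProb, Finset.sum_mul]
  refine hasSum_sum fun σ _ => ?_
  have := hasSum_single (f := fun k => (θ ^ totalCycles σ / risingFactorial θ n *
    if k = cyclesIn σ J then 1 else 0) * (k.descFactorial l : ℝ)) (cyclesIn σ J)
    fun k hk => by simp [hk]
  simpa using this

theorem momentSum_zero (hθ : 0 < θ) (J : Finset ℕ) (n : ℕ) : momentSum θ J n 0 = 1 := by
  simp [momentSum, tupleWeight, Polynomial.coeff_one, (risingCoeff_pos hθ n).ne']

/-- Since l + 1 ≤ 2^l, the terms are dominated by an exponential series at 4θC. -/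
theorem summable_moment_bound (hθ : 0 < θ) {A C : ℝ} (hA : 0 < A) (hC : 1 ≤ C) :
    Summable fun l : ℕ => 2 ^ l * (θ ^ l * (A * (l + 1) * C ^ l) / l !) := by
  refine Summable.of_nonneg_of_le (fun l => by positivity) (fun l => ?_)
    ((Real.summable_pow_div_factorial (4 * θ * C)).mul_left A)
  have h : (l : ℝ) + 1 ≤ 2 ^ l := by exact_mod_cast Nat.lt_two_pow_self (n := l)
  calc _ = A * ((l + 1) * (2 * θ * C) ^ l / l !) := by rw [mul_pow, mul_pow]; ring
    _ ≤ A * (2 ^ l * (2 * θ * C) ^ l / l !) := by gcongr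
    _ = _ := by rw [← mul_pow]; ring_nf

theorem exists_recipSum_le_of_upsilon (hθ : 0 < θ) {J : ℕ → Finset ℕ}
    (hJ : ∀ n, J n ⊆ Finset.Icc 1 n) {u : ℝ}
    (hu : Tendsto (fun n => upsilon θ J n 1) atTop (𝓝 u)) :
    ∃ C, 1 ≤ C ∧ ∀ n, recipSum (J n) ≤ C := by
  obtain ⟨c, hc, h⟩ := exists_le_upsilon_one hθ
  obtain ⟨B, hB⟩ := hu.bddAbove_range
  refine ⟨max 1 (B / c + 2), le_max_left _ _, fun n => le_max_of_le_right ?_⟩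
  have := (h n J (hJ n)).trans (hB ⟨n, rfl⟩)
  rw [← le_div_iff₀' hc] at this
  linarith

theorem exists_recipSum_le_of_tendsto (hθ : 0 < θ) {J : ℕ → Finset ℕ}
    (hJ : ∀ n, J n ⊆ Finset.Icc 1 n) {p : ℕ → ℝ} (hp : HasSum p 1)
    (h : ∀ k, Tendsto (fun n => cycleProb θ (J n) n k) atTop (𝓝 (p k))) :
    ∃ C, 1 ≤ C ∧ ∀ n, recipSum (J n) ≤ C := by
  obtain ⟨c, hc, hlow⟩ := exists_le_momentSum_one hθ
  obtain ⟨A, hA, hup⟩ := exists_momentSum_le hθ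
  have hJ0 (n : ℕ) : 0 ∉ J n := fun h0 => by simpa using hJ n h0
  -- With D = `recipSum (J n)` ≥ 1, E w² ≤ E·D² by the moment bounds for l = 2 and l = 1. Taking t =
  -- η/D in `moment_one_le`, η and δ keep each error term within θcD/8. For D ≥ 4 the mean is at
  -- least θcD/2, which leaves θcD/4 ≤ K.
  set E := 3 * θ ^ 2 * A + 2 * θ * A with hE
  have hEpos : 0 < E := by positivity
  set η := θ * c / (8 * E) with hη
  have hηpos : 0 < η := by positivity
  set δ := θ * c * η / 2 with hδ
  have hδpos : 0 < δ := by positivity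
  obtain ⟨K, hK⟩ := (hp.tendsto_sum_nat.eventually_const_lt
    (show 1 - δ < 1 by linarith)).exists
  have hev : ∀ᶠ n in atTop, 1 - δ < ∑ k ∈ Finset.range K, cycleProb θ (J n) n k :=
    (tendsto_finsetSum _ fun k _ => h k).eventually_const_lt hK
  have hbd : ∀ᶠ n in atTop, recipSum (J n) ≤ max 4 (4 * K / (θ * c)) := by
    filter_upwards [hev] with n hn
    rcases le_total (recipSum (J n)) 4 with h4 | h4
    · exact le_max_of_le_left h4
    refine le_max_of_le_right ?_
    set D := recipSum (J n) with hD
    have hDpos : 0 < D := by linarith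
    have h1 := moment_one_le (cycleProb_nonneg hθ (J n) n)
      (M := fun l => θ ^ l * momentSum θ (J n) n l) (by simp [momentSum_zero hθ])
      (hasSum_cycleProb hθ (hJ0 n) n) (t := η / D) (by positivity) hn.le
    have h2 := mul_le_mul_of_nonneg_left (hlow n (J n) (hJ n)) hθ.le
    have h3 := mul_le_mul_of_nonneg_left (hup n (J n) D (by linarith) le_rfl 1) hθ.le
    have h4' := mul_le_mul_of_nonneg_left (hup n (J n) D (by linarith) le_rfl 2)
      (sq_nonneg θ)
    simp only [pow_one] at h1 h3
    push_cast at h3 h4'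
    have h5 : θ ^ 2 * momentSum θ (J n) n 2 + θ * momentSum θ (J n) n 1 ≤ E * D ^ 2 := by
      have : 2 * θ * A * D ≤ 2 * θ * A * D ^ 2 := by
        gcongr
        nlinarith
      rw [hE]
      linarith
    have h6 : η / D * (θ ^ 2 * momentSum θ (J n) n 2 + θ * momentSum θ (J n) n 1) ≤
        θ * c / 8 * D := by
      calc _ ≤ η / D * (E * D ^ 2) := by gcongr
        _ = _ := by rw [hη]; field_simp
    have h7 : δ / (4 * (η / D)) = θ * c / 8 * D := by
      rw [hδ]; field_simp; norm_num
    rw [h7] at h1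
    have h8 : θ * c * (D / 2) ≤ θ * (c * (D - 2)) := by
      rw [mul_assoc]
      gcongr
      linarith
    rw [le_div_iff₀ (by positivity)]
    linarith
  obtain ⟨B, hB⟩ := (isBoundedUnder_of_eventually_le hbd).bddAbove_range
  exact ⟨max 1 B, le_max_left _ _, fun n => le_max_of_le_right (hB ⟨n, rfl⟩)⟩

theorem tendsto_moment_sub_upsilon (hθ : 0 < θ) {J : ℕ → Finset ℕ} {C : ℝ} (hC : 1 ≤ C)
    (hJC : ∀ n, recipSum (J n) ≤ C) (l : ℕ) :
    Tendsto (fun n => θ ^ l * momentSum θ (J n) n l - upsilon θ J n l) atTop (𝓝 0) := by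
  have := (tendsto_momentSum_sub hθ J hC hJC l).const_mul (θ ^ l)
  simpa only [mul_zero, mul_sub, ← upsilon_eq] using this

/-- Pointwise convergence of the laws forces the convergence of `υ_n(l)` to the factorial moments
of the limit. -/
theorem tendsto_upsilon_of_tendsto_cycleProb (hθ : 0 < θ) {J : ℕ → Finset ℕ}
    (hJ : ∀ n, J n ⊆ Finset.Icc 1 n) {p : ℕ → ℝ} (hp : HasSum p 1)
    (h : ∀ k, Tendsto (fun n => cycleProb θ (J n) n k) atTop (𝓝 (p k))) (l : ℕ) :
    ∃ m, HasSum (fun k => p k * (k.descFactorial l : ℝ)) m ∧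
      Tendsto (fun n => upsilon θ J n l) atTop (𝓝 m) := by
  obtain ⟨C, hC, hJC⟩ := exists_recipSum_le_of_tendsto hθ hJ hp h
  obtain ⟨A, hA, hup⟩ := exists_momentSum_le hθ
  have hJ0 (n : ℕ) : 0 ∉ J n := fun h0 => by simpa using hJ n h0
  obtain ⟨m, hm, hlim⟩ := tendsto_moment (fun n => cycleProb_nonneg hθ (J n) n) h
    (fun n => hasSum_cycleProb hθ (hJ0 n) n) (B := fun l => θ ^ l * (A * (l + 1) * C ^ l))
    (fun n l => mul_le_mul_of_nonneg_left (hup n (J n) C hC (hJC n) l) (by positivity)) l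
  refine ⟨m, hm, ?_⟩
  simpa using hlim.sub (tendsto_moment_sub_upsilon hθ hC hJC l)

/-- The limiting probability of `k` when the factorial moments are `u`. -/
noncomputable def inversionSum (u : ℕ → ℝ) (k : ℕ) : ℝ :=
  ∑' l : ℕ, (-1 : ℝ) ^ (l + k) * l.choose k * ((if l = 0 then 1 else u l) / l !)

/-- Convergence of `υ_n(l)` forces the pointwise convergence of the laws; the limit is a
probability law, and the only one with the limiting factorial moments. -/
theorem tendsto_cycleProb_of_tendsto_upsilon (hθ : 0 < θ) {J : ℕ → Finset ℕ}
    (hJ : ∀ n, J n ⊆ Finset.Icc 1 n) {u : ℕ → ℝ}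
    (hu : ∀ l, 1 ≤ l → Tendsto (fun n => upsilon θ J n l) atTop (𝓝 (u l))) :
    (∀ k, Tendsto (fun n => cycleProb θ (J n) n k) atTop (𝓝 (inversionSum u k))) ∧
    HasSum (inversionSum u) 1 ∧
    ∀ p : ℕ → ℝ, (∀ k, 0 ≤ p k) → HasSum p 1 →
      (∀ l, 1 ≤ l → HasSum (fun k => p k * (k.descFactorial l : ℝ)) (u l)) →
        ∀ k, p k = inversionSum u k := by
  obtain ⟨C, hC, hJC⟩ := exists_recipSum_le_of_upsilon hθ hJ (hu 1 le_rfl)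
  obtain ⟨A, hA, hup⟩ := exists_momentSum_le hθ
  have hJ0 (n : ℕ) : 0 ∉ J n := fun h0 => by simpa using hJ n h0
  have hM (n l : ℕ) := hasSum_cycleProb hθ (hJ0 n) n l
  have hB (n l : ℕ) : θ ^ l * momentSum θ (J n) n l ≤ θ ^ l * (A * (l + 1) * C ^ l) :=
    mul_le_mul_of_nonneg_left (hup n (J n) C hC (hJC n) l) (by positivity)
  have hq (n : ℕ) := cycleProb_nonneg hθ (J n) n
  -- The hypothesis says nothing about `u 0`; the zeroth moment is 1, which the case split supplies.
  have hlim (l : ℕ) : Tendsto (fun n => θ ^ l * momentSum θ (J n) n l) atTop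
      (𝓝 (if l = 0 then 1 else u l)) := by
    split_ifs with hl
    · subst hl
      simp [momentSum_zero hθ]
    · simpa using (tendsto_moment_sub_upsilon hθ hC hJC l).add (hu l (Nat.pos_of_ne_zero hl))
  have hconv := tendsto_of_tendsto_moment hq hM hB (summable_moment_bound hθ hA hC) hlim
  refine ⟨hconv, ?_, fun p hp h1 hpu => ?_⟩
  -- The case l = 0 shows that no mass escapes: the total mass of the limit is the limit of the
  -- total masses.
  · obtain ⟨m, hm, hm'⟩ := tendsto_moment hq hconv hM hB 0
    have := tendsto_nhds_unique hm' (hlim 0)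
    subst this
    change HasSum (fun k => inversionSum u k * (k.descFactorial 0 : ℝ)) _ at hm
    simpa using hm
  · refine eq_tsum_of_hasSum_moment hp (m := fun l => if l = 0 then 1 else u l) (fun l => ?_)
      (fun l => le_of_tendsto' (hlim l) fun n => hB n l) (summable_moment_bound hθ hA hC)
    split_ifs with hl
    · subst hl
      simpa using h1
    · exact hpu l (Nat.pos_of_ne_zero hl)

theorem hasSum_measureReal_singleton (μ : Measure ℕ) [IsProbabilityMeasure μ] :
    HasSum (fun k => μ.real {k}) 1 := by
  have := (integrable_and_integral_eq_iff (μ := μ) (f := fun _ => 1) (c := 1)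
    fun _ => zero_le_one).1 ⟨integrable_const _, by simp⟩
  simpa using this

theorem weakConv_cycleDistFun_iff (J : ℕ → Finset ℕ) (μ : Measure ℕ) [IsProbabilityMeasure μ] :
    WeakConv (cycleDistFun θ J) (lawDistFun μ) ↔
      ∀ k, Tendsto (fun n => cycleProb θ (J n) n k) atTop (𝓝 (μ.real {k})) := by
  rw [cycleDistFun_eq, weakConv_iff]

end Ewens

theorem corollary3 (θ : ℝ) (hθ : 0 < θ) (J : ℕ → Finset ℕ)
    (hJ : ∀ n : ℕ, J n ⊆ Finset.Icc 1 n) :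
    ((∃ μ : Measure ℕ, IsProbabilityMeasure μ ∧
        Ewens.WeakConv (Ewens.cycleDistFun θ J) (Ewens.lawDistFun μ)) ↔
      ∃ υ : ℕ → ℝ, ∀ l : ℕ, 1 ≤ l →
        Tendsto (fun n => Ewens.upsilon θ J n l) atTop (𝓝 (υ l))) ∧
    ∀ υ : ℕ → ℝ,
      (∀ l : ℕ, 1 ≤ l → Tendsto (fun n => Ewens.upsilon θ J n l) atTop (𝓝 (υ l))) →
      ∀ μ : Measure ℕ, IsProbabilityMeasure μ →
        (Ewens.WeakConv (Ewens.cycleDistFun θ J) (Ewens.lawDistFun μ) ↔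
          ∀ l : ℕ, 1 ≤ l →
            Integrable (fun k : ℕ => (k.descFactorial l : ℝ)) μ ∧
              ∫ k : ℕ, (k.descFactorial l : ℝ) ∂μ = υ l) := by
  refine ⟨⟨?_, ?_⟩, fun υ hυ μ hμ => ?_⟩
  · rintro ⟨μ, hμ, h⟩
    choose m _ hm using Ewens.tendsto_upsilon_of_tendsto_cycleProb hθ hJ
      (Ewens.hasSum_measureReal_singleton μ) ((Ewens.weakConv_cycleDistFun_iff J μ).1 h)
    exact ⟨m, fun l _ => hm l⟩
  · rintro ⟨υ, hυ⟩
    obtain ⟨h1, h2, -⟩ := Ewens.tendsto_cycleProb_of_tendsto_upsilon hθ hJ hυ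
    obtain ⟨μ, hμ, h⟩ := Ewens.exists_probabilityMeasure_real_eq
      (fun k => ge_of_tendsto' (h1 k) fun n => Ewens.cycleProb_nonneg hθ (J n) n k) h2
    refine ⟨μ, hμ, (Ewens.weakConv_cycleDistFun_iff J μ).2 fun k => ?_⟩
    rw [h k]
    exact h1 k
  · simp only [Ewens.integrable_and_integral_eq_iff fun k => Nat.cast_nonneg _]
    rw [Ewens.weakConv_cycleDistFun_iff]
    have hs := Ewens.hasSum_measureReal_singleton μ
    constructor
    · intro h l hl
      obtain ⟨m, hm, hm'⟩ := Ewens.tendsto_upsilon_of_tendsto_cycleProb hθ hJ hs h l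
      rwa [tendsto_nhds_unique (hυ l hl) hm']
    · intro h k
      obtain ⟨h1, -, h3⟩ := Ewens.tendsto_cycleProb_of_tendsto_upsilon hθ hJ hυ
      rw [h3 _ (fun _ => measureReal_nonneg) hs h k]
      exact h1 k
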